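/- Let $\Omega$ be a finite set and $f:\Omega\to[0,\infty)$ a (known) function. For a probability distribution $D$ on $\Omega$ write $\mu=\sum_x D(x)f(x)$, $\phi=\sum_x D(x)f(x)^2$, $|\psi_D\rangle=\sum_{x}\sqrt{D(x)}\,|x\rangle$ and $R_D=2|\psi_D\rangle\langle\psi_D|-I$. There is a universal constant $C>0$ such that for all such $\Omega$, $f$ and all real $B\ge 1$, $\varepsilon>0$, $\eta\in(0,1)$ there is a quantum algorithm $\mathcal A$ (with a finite workspace, arbitrary unitaries not depending on $D$, intermediate measurements with adaptive continuation, and invocations of the controlled reflection $R_D$) that invokes the controlled reflection at most $$C\cdot\frac{\sqrt B}{\varepsilon}\cdot\big(\ln(e+B/\varepsilon)\big)^{1.5}\cdot\ln\!\Big(\frac{\ln(e+B/\varepsilon)}{\eta}\Big)$$ times for every sequence of measurement outcomes, i.e. $O\big(\sqrt B/\varepsilon\cdot(\ln(B/\varepsilon))^{1.5}\cdot\ln(\ln(B/\varepsilon)/\eta)\big)$ times when, say, $B/\varepsilon\ge e$ and $\eta\le 1/2$, and that has the following properties for every probability distribution $D$ on $\Omega$ whose second moment satisfies $\phi\le B$.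 Started from one copy of $|\psi_D\rangle$ (and a fixed basis state of the workspace), (i) with probability at least $1-\eta$, $\mathcal A$ outputs a number $\hat\mu$ with $|\mu-\hat\mu|\le\varepsilon$; (ii) with probability at least $1-\eta$, $\mathcal A$ restores the state $|\psi_D\rangle$, i.e. it leaves the register $\Omega$ in the state $|\psi_D\rangle$, unentangled with the workspace. -/

import Mathlib

/-- The mean `μ = 𝔼_{x ∼ D} [f x]`. -/
noncomputable def mean {Ω : Type*} [Fintype Ω] (D f : Ω → ℝ) : ℝ := ∑ x, D x * f x

/-- The second moment `φ = 𝔼_{x ∼ D} [(f x)²]`. -/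
noncomputable def secondMoment {Ω : Type*} [Fintype Ω] (D f : Ω → ℝ) : ℝ := ∑ x, D x * f x ^ 2

/-- The coherent encoding `|ψ_D⟩ = ∑ x, √(D x) |x⟩`. -/
noncomputable def coherentEncoding {Ω : Type*} (D : Ω → ℝ) : EuclideanSpace ℂ Ω :=
  WithLp.toLp 2 fun x => (Real.sqrt (D x) : ℂ)

/-- The reflection `2|ψ⟩⟨ψ| - I`, applied to the vector `v`. -/
noncomputable def reflect {Ω : Type*} [Fintype Ω] (ψ v : EuclideanSpace ℂ Ω) :
    EuclideanSpace ℂ Ω :=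
  (2 * inner ℂ ψ v) • ψ - v

/-- The product state `|ψ⟩ ⊗ |χ⟩` of the register `Ω` and the workspace `W`. -/
noncomputable def tensorState {Ω W : Type*} (ψ : EuclideanSpace ℂ Ω) (χ : EuclideanSpace ℂ W) :
    EuclideanSpace ℂ (Ω × W) :=
  WithLp.toLp 2 fun p => ψ p.1 * χ p.2

/-- The controlled reflection on `ℂ^Ω ⊗ ℂ^W`: the reflection `2|ψ⟩⟨ψ| - I` is applied to the
register `Ω` on those basis states `w` of the workspace whose control bit `c w` is on, and nothing
happens on the other ones. -/
noncomputable def controlledReflect {Ω W : Type*} [Fintype Ω] (ψ : EuclideanSpace ℂ Ω)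
    (c : W → Bool) (v : EuclideanSpace ℂ (Ω × W)) : EuclideanSpace ℂ (Ω × W) :=
  WithLp.toLp 2 fun p =>
    if c p.2 then reflect ψ (WithLp.toLp 2 fun x => v (x, p.2)) p.1 else v p

/-- The (unnormalized) state after a measurement in the computational basis of the quantity `g`
that gave the outcome `i`. -/
noncomputable def collapse {S : Type*} {m : ℕ} (g : S → Fin m) (i : Fin m)
    (v : EuclideanSpace ℂ S) : EuclideanSpace ℂ S :=
  WithLp.toLp 2 fun p => if g p = i then v p else 0

/-- Quantum algorithms with access to the controlled reflection about an unknown state of the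
register `Ω`, with a finite workspace `W`. The algorithm may apply any unitary that does not depend
on the unknown state, query the controlled reflection, perform intermediate measurements and
continue adaptively, and it ends with a real number as its output. -/
inductive QueryAlg (Ω W : Type*) [Fintype Ω] [Fintype W] where
  /-- Stop and output the number `r`. -/
  | ret (r : ℝ) : QueryAlg Ω W
  /-- Apply the unitary `U` to register and workspace, and continue. -/
  | gate (U : EuclideanSpace ℂ (Ω × W) ≃ₗᵢ[ℂ] EuclideanSpace ℂ (Ω × W))
      (next : QueryAlg Ω W) : QueryAlg Ω W
  /-- Invoke the controlled reflection once, with control bit `c`, and continue. -/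
  | query (c : W → Bool) (next : QueryAlg Ω W) : QueryAlg Ω W
  /-- Measure the quantity `g` and continue according to the outcome. -/
  | measure (m : ℕ) (g : Ω × W → Fin m) (next : Fin m → QueryAlg Ω W) : QueryAlg Ω W

namespace QueryAlg

variable {Ω W : Type*} [Fintype Ω] [Fintype W]

/-- The number of invocations of the controlled reflection, in the worst case over all measurement
outcomes. -/
def queries : QueryAlg Ω W → ℕ
  | ret _ => 0
  | gate _ next => next.queries
  | query _ next => next.queries + 1
  | measure _ _ next => Finset.univ.sup fun i => (next i).queries

open Classical in
/-- `A.prob ψ P v` is the probability that the algorithm `A`, run from the state `v` with access to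
the controlled reflection about `ψ`, ends with an output `r` and a final state `v'` for which
`P r v'` holds. States of the branches are not normalized: the squared norm of the final state of a
branch is the probability of that branch (Born rule). -/
noncomputable def prob (ψ : EuclideanSpace ℂ Ω) (P : ℝ → EuclideanSpace ℂ (Ω × W) → Prop) :
    QueryAlg Ω W → EuclideanSpace ℂ (Ω × W) → ℝ
  | ret r, v => if P r v then ‖v‖ ^ 2 else 0
  | gate U next, v => next.prob ψ P (U v)
  | query c next, v => next.prob ψ P (controlledReflect ψ c v)
  | measure _ g next, v => ∑ i, (next i).prob ψ P (collapse g i v)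

end QueryAlg

/-! Dividing `f` by `√B` gives a function g with second moment at most 1. It is cut at powers of
two: level l holds the values of g of order 2^l, scaled into [0, 1], and p_l is its mean. The values
of g above 2^n contribute at most 2^(-n) to the mean, so about log(√B/ε) levels suffice.

For one level the function is encoded in the cosines c of qubit rotations. The rotation followed by
the controlled reflection is a product of two reflections, one about |ψ_D, 0⟩; it preserves a plane
through |ψ_D, 0⟩ and rotates it by the angle φ with cos φ = 𝔼 c (`groverStep_planeState`). Phase
estimation with a sine window on t points finds ±φ up to O(1/t) with constant probability, and the
median of several outcomes gives p_l up to O(√p_l / t + 1/t²) (`abs_cos_sub_cos_le_of_isAccurate`,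
`abs_dyadic_estimate_le`). By Cauchy–Schwarz and the second moment bound, ∑ 2^l √p_l is only of the
order of the square root of the number of levels, so t of order √(log(√B/ε)) · √B/ε serves all
levels.

The input state survives because an ancilla tests, in each round, which of two orthogonal vectors of
the plane is present (`prob_phaseRound`). The rounds form a Markov chain on these two vectors, and a
round flips them with probability at least 1/4 if sin φ ≥ 2π/t (`quarter_le_sum_phaseWeight_true`);
a shift of the cosines by 40/t² guarantees this. After R rounds for the estimate, at most 3R more
restore |ψ_D⟩ exactly, up to failure probability 2^(-R), and the next level starts from the same
product state. Taking R logarithmic in (number of levels)/η absorbs all failures. -/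

section Generic

/-! ### Homogeneity and monotonicity of outcome probabilities -/

variable {Ω W : Type*} [Fintype Ω]

theorem reflect_smul (ψ : EuclideanSpace ℂ Ω) (k : ℂ) (v : EuclideanSpace ℂ Ω) :
    reflect ψ (k • v) = k • reflect ψ v := by
  simp only [reflect, inner_smul_right, smul_sub, smul_smul]
  congr 2
  ring

theorem controlledReflect_smul (ψ : EuclideanSpace ℂ Ω) (c : W → Bool) (k : ℂ)
    (v : EuclideanSpace ℂ (Ω × W)) :
    controlledReflect ψ c (k • v) = k • controlledReflect ψ c v := by
  ext p
  have h : (WithLp.toLp 2 fun x => (k • v) (x, p.2) : EuclideanSpace ℂ Ω) =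
      k • WithLp.toLp 2 fun x => v (x, p.2) := by
    ext x; simp
  by_cases hc : c p.2
  · simp only [controlledReflect, hc, if_true]
    rw [h, reflect_smul, PiLp.smul_apply, PiLp.smul_apply]
    simp only [hc, if_true]
  · simp [controlledReflect, hc]

theorem collapse_smul {S : Type*} {m : ℕ} (g : S → Fin m) (i : Fin m) (k : ℂ)
    (v : EuclideanSpace ℂ S) : collapse g i (k • v) = k • collapse g i v := by
  ext p
  by_cases h : g p = i <;> simp [collapse, h]

namespace QueryAlg

variable [Fintype W]

theorem prob_nonneg (ψ : EuclideanSpace ℂ Ω) (P : ℝ → EuclideanSpace ℂ (Ω × W) → Prop)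
    (A : QueryAlg Ω W) : ∀ v, 0 ≤ A.prob ψ P v := by
  induction A with
  | ret r => intro v; simp only [prob]; split_ifs <;> positivity
  | gate U next ih => intro v; exact ih _
  | query c next ih => intro v; exact ih _
  | measure m g next ih => intro v; exact Finset.sum_nonneg fun i _ => ih i _

theorem prob_mono (ψ : EuclideanSpace ℂ Ω) {P Q : ℝ → EuclideanSpace ℂ (Ω × W) → Prop}
    (h : ∀ r v, P r v → Q r v) (A : QueryAlg Ω W) :
    ∀ v, A.prob ψ P v ≤ A.prob ψ Q v := by
  induction A with
  | ret r =>
    intro v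
    simp only [prob]
    by_cases hP : P r v
    · simp [hP, h r v hP]
    · rw [if_neg hP]; split_ifs <;> positivity
  | gate U next ih => intro v; exact ih _
  | query c next ih => intro v; exact ih _
  | measure m g next ih => intro v; exact Finset.sum_le_sum fun i _ => ih i _

/-- All operations are linear and the Born rule is quadratic. This is what extracts the weight of a
measurement branch, whose unnormalized state is a multiple of a known one. -/
theorem prob_smul (ψ : EuclideanSpace ℂ Ω) {P : ℝ → EuclideanSpace ℂ (Ω × W) → Prop}
    (hP : ∀ r v (k : ℂ), k ≠ 0 → (P r (k • v) ↔ P r v)) (A : QueryAlg Ω W) (k : ℂ) :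
    ∀ v, A.prob ψ P (k • v) = ‖k‖ ^ 2 * A.prob ψ P v := by
  induction A with
  | ret r =>
    intro v
    by_cases hk : k = 0
    · simp [prob, hk]
    · by_cases h : P r v
      · simp only [prob, if_pos h, if_pos ((hP r v k hk).2 h), norm_smul, mul_pow]
      · simp only [prob, if_neg h, if_neg (mt (hP r v k hk).1 h), mul_zero]
  | gate U next ih => intro v; simp only [prob, map_smul, ih]
  | query c next ih => intro v; simp only [prob, controlledReflect_smul, ih]
  | measure m g next ih =>
    intro v
    simp only [prob, collapse_smul, ih, Finset.mul_sum]

end QueryAlg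

end Generic

/-! ### Unitaries independent of the distribution -/

section Gates

/-- A linear endomorphism of a finite-dimensional Euclidean space that preserves the sum of the
squared moduli of the coordinates, as a unitary. -/
noncomputable def unitaryOfNormSq {ι : Type*} [Fintype ι]
    (T : EuclideanSpace ℂ ι →ₗ[ℂ] EuclideanSpace ℂ ι)
    (h : ∀ v, ∑ i, ‖T v i‖ ^ 2 = ∑ i, ‖v i‖ ^ 2) :
    EuclideanSpace ℂ ι ≃ₗᵢ[ℂ] EuclideanSpace ℂ ι :=
  LinearIsometry.toLinearIsometryEquiv
    ⟨T, fun v => by rw [EuclideanSpace.norm_eq, EuclideanSpace.norm_eq, h]⟩ rfl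

theorem exists_unitary_apply_eq {ι : Type*} [Fintype ι] (x y : EuclideanSpace ℂ ι)
    (hx : ‖x‖ = 1) (hy : ‖y‖ = 1) :
    ∃ U : EuclideanSpace ℂ ι ≃ₗᵢ[ℂ] EuclideanSpace ℂ ι, U x = y := by
  have hx0 : x ≠ 0 := by rintro rfl; simp at hx
  let e : ℂ ≃ₗᵢ[ℂ] Submodule.span ℂ {x} := LinearIsometryEquiv.toSpanUnitSingleton x hx
  let f : (Submodule.span ℂ {x}) →ₗᵢ[ℂ] EuclideanSpace ℂ ι :=
    (⟨LinearMap.toSpanSingleton ℂ _ y, fun k => by simp [norm_smul, hy]⟩ :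
      ℂ →ₗᵢ[ℂ] EuclideanSpace ℂ ι).comp e.symm.toLinearIsometry
  refine ⟨f.extend.toLinearIsometryEquiv rfl, ?_⟩
  have h1 := f.extend_apply ⟨x, Submodule.mem_span_singleton_self x⟩
  have h2 : e.symm ⟨x, Submodule.mem_span_singleton_self x⟩ = 1 := by
    rw [LinearIsometryEquiv.symm_apply_eq]
    ext1
    simp [e, LinearIsometryEquiv.toSpanUnitSingleton_apply]
  simpa [f, h2] using h1

/-- A unitary that takes the vector `x` to the vector `y`; both have to be unit vectors. -/
noncomputable def moveUnitary {ι : Type*} [Fintype ι] (x y : EuclideanSpace ℂ ι)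
    (hx : ‖x‖ = 1) (hy : ‖y‖ = 1) : EuclideanSpace ℂ ι ≃ₗᵢ[ℂ] EuclideanSpace ℂ ι :=
  (exists_unitary_apply_eq x y hx hy).choose

theorem moveUnitary_apply {ι : Type*} [Fintype ι] (x y : EuclideanSpace ℂ ι)
    (hx : ‖x‖ = 1) (hy : ‖y‖ = 1) : moveUnitary x y hx hy x = y :=
  (exists_unitary_apply_eq x y hx hy).choose_spec

variable {Ω J : Type*} [Fintype Ω] [Fintype J]

/-- A family of real orthogonal transformations of a qubit, controlled by the register `Ω` and the
workspace `J`. -/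
noncomputable def qubitGate (m : Ω → J → Bool → Bool → ℝ)
    (h : ∀ x j (z : Bool → ℂ), ∑ q, ‖∑ q', (m x j q q' : ℂ) * z q'‖ ^ 2 = ∑ q, ‖z q‖ ^ 2) :
    EuclideanSpace ℂ (Ω × Bool × J) ≃ₗᵢ[ℂ] EuclideanSpace ℂ (Ω × Bool × J) :=
  unitaryOfNormSq
    { toFun := fun v => WithLp.toLp 2 fun p =>
        ∑ q', (m p.1 p.2.2 p.2.1 q' : ℂ) * v (p.1, q', p.2.2)
      map_add' := fun v w => by
        ext p; simp only [PiLp.add_apply, mul_add, Finset.sum_add_distrib]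
      map_smul' := fun k v => by
        ext p
        simp only [PiLp.smul_apply, smul_eq_mul, RingHom.id_apply, Finset.mul_sum]
        exact Finset.sum_congr rfl fun q _ => by ring }
    (fun v => by
      simp only [LinearMap.coe_mk, AddHom.coe_mk, Fintype.sum_prod_type]
      refine Finset.sum_congr rfl fun x _ => ?_
      rw [Finset.sum_comm, Finset.sum_comm (f := fun a b => ‖v (x, a, b)‖ ^ 2)]
      exact Finset.sum_congr rfl fun j _ => h x j fun q => v (x, q, j))

theorem qubitGate_apply (m : Ω → J → Bool → Bool → ℝ)
    (h : ∀ x j (z : Bool → ℂ), ∑ q, ‖∑ q', (m x j q q' : ℂ) * z q'‖ ^ 2 = ∑ q, ‖z q‖ ^ 2)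
    (v : EuclideanSpace ℂ (Ω × Bool × J)) (x : Ω) (q : Bool) (j : J) :
    qubitGate m h v (x, q, j) = ∑ q', (m x j q q' : ℂ) * v (x, q', j) := rfl

/-- A unitary of the workspace `J`, extended by the identity. -/
noncomputable def workGate (V : EuclideanSpace ℂ J ≃ₗᵢ[ℂ] EuclideanSpace ℂ J) :
    EuclideanSpace ℂ (Ω × Bool × J) ≃ₗᵢ[ℂ] EuclideanSpace ℂ (Ω × Bool × J) :=
  unitaryOfNormSq
    { toFun := fun v => WithLp.toLp 2 fun p =>
        V (WithLp.toLp 2 fun j => v (p.1, p.2.1, j)) p.2.2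
      map_add' := fun v w => by
        ext p
        simp only [PiLp.add_apply]
        rw [← PiLp.add_apply, ← map_add]
        rfl
      map_smul' := fun k v => by
        ext p
        simp only [PiLp.smul_apply, RingHom.id_apply]
        rw [← PiLp.smul_apply, ← map_smul]
        rfl }
    (fun v => by
      simp only [LinearMap.coe_mk, AddHom.coe_mk, Fintype.sum_prod_type]
      refine Finset.sum_congr rfl fun x _ => Finset.sum_congr rfl fun q _ => ?_
      rw [← EuclideanSpace.norm_sq_eq, LinearIsometryEquiv.norm_map, EuclideanSpace.norm_sq_eq])

end Gates

/-! ### The invariant plane and the Grover iterate -/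

section Plane

variable {Ω J : Type*} [Fintype Ω]

/-- The vector `a ⊗ |ψ_D, 0⟩ + b ⊗ |ψ_D^⊥⟩`, where `|ψ_D^⊥⟩` is the unit vector that spans,
together with `|ψ_D, 0⟩`, the plane that contains `∑ x, √(D x) |x⟩ (c x |0⟩ + √(1 - (c x)²) |1⟩)`. -/
noncomputable def planeState (D c : Ω → ℝ) (a b : J → ℂ) : EuclideanSpace ℂ (Ω × Bool × J) :=
  WithLp.toLp 2 fun p =>
    if p.2.1 then
      -((√(D p.1) * (√(1 - c p.1 ^ 2) / √(1 - mean D c ^ 2)) : ℝ) : ℂ) * b p.2.2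
    else
      (√(D p.1) : ℂ) * a p.2.2 +
        ((√(D p.1) * ((mean D c - c p.1) / √(1 - mean D c ^ 2)) : ℝ) : ℂ) * b p.2.2

theorem planeState_smul (D c : Ω → ℝ) (k : ℂ) (a b : J → ℂ) :
    planeState D c (k • a) (k • b) = k • planeState D c a b := by
  ext ⟨x, q, j⟩
  cases q <;> simp [planeState] <;> ring

/-- The first basis vector of the plane does not depend on `c`. Hence a level that ends there can be
followed by a level with other cosines, that is, another plane. -/
theorem planeState_single [DecidableEq J] (D c : Ω → ℝ) (j₀ : J) :
    planeState D c (Pi.single j₀ 1) 0 =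
      tensorState (coherentEncoding D) (EuclideanSpace.single (false, j₀) 1) := by
  ext ⟨x, q, j⟩
  cases q <;> simp [planeState, tensorState, coherentEncoding, Pi.single_apply]

theorem norm_sq_tensorState_single {W : Type*} [Fintype W] [DecidableEq W] {D : Ω → ℝ}
    (hD : D ∈ stdSimplex ℝ Ω) (w₀ : W) :
    ‖tensorState (coherentEncoding D) (EuclideanSpace.single w₀ (1 : ℂ))‖ ^ 2 = 1 := by
  rw [EuclideanSpace.norm_sq_eq, Fintype.sum_prod_type, ← hD.2]
  refine Finset.sum_congr rfl fun x _ => ?_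
  rw [Finset.sum_eq_single w₀]
  · simp [tensorState, coherentEncoding, Real.sq_sqrt (hD.1 x)]
  · intro w _ hw
    simp [tensorState, hw]
  · simp

theorem workGate_planeState [Fintype J] (D c : Ω → ℝ)
    (V : EuclideanSpace ℂ J ≃ₗᵢ[ℂ] EuclideanSpace ℂ J)
    (a b : J → ℂ) :
    workGate V (planeState D c a b) =
      planeState D c (V (WithLp.toLp 2 a)) (V (WithLp.toLp 2 b)) := by
  ext ⟨x, q, j⟩
  change V (WithLp.toLp 2 fun j => planeState D c a b (x, q, j)) j = _
  cases q
  · have h : (WithLp.toLp 2 fun j => planeState D c a b (x, false, j) : EuclideanSpace ℂ J) =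
        (√(D x) : ℂ) • WithLp.toLp 2 a +
        ((√(D x) * ((mean D c - c x) / √(1 - mean D c ^ 2)) : ℝ) : ℂ) • WithLp.toLp 2 b := by
      ext j; simp [planeState]
    rw [h, map_add, map_smul, map_smul]
    simp [planeState]
  · have h : (WithLp.toLp 2 fun j => planeState D c a b (x, true, j) : EuclideanSpace ℂ J) =
        (-((√(D x) * (√(1 - c x ^ 2) / √(1 - mean D c ^ 2)) : ℝ) : ℂ)) • WithLp.toLp 2 b := by
      ext j; simp [planeState]
    rw [h, map_smul]
    simp [planeState]

theorem collapse_planeState {m : ℕ} (D c : Ω → ℝ) (g : J → Fin m) (i : Fin m) (a b : J → ℂ) :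
    collapse (fun p : Ω × Bool × J => g p.2.2) i (planeState D c a b) =
      planeState D c (fun j => if g j = i then a j else 0) fun j => if g j = i then b j else 0 := by
  ext ⟨x, q, j⟩
  by_cases h : g j = i <;> cases q <;> simp [planeState, collapse, h]

/-- The reflection about `|ψ_D⟩`, applied to a vector with coordinates `√(D x) (k x)`. -/
theorem reflect_coherentEncoding_apply {D : Ω → ℝ} (hD : D ∈ stdSimplex ℝ Ω) (k : Ω → ℂ) (x : Ω) :
    reflect (coherentEncoding D) (WithLp.toLp 2 fun x => (√(D x) : ℂ) * k x) x =
      (√(D x) : ℂ) * (2 * ∑ y, (D y : ℂ) * k y - k x) := by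
  have h : inner ℂ (coherentEncoding D) (WithLp.toLp 2 fun x => (√(D x) : ℂ) * k x) =
      ∑ y, (D y : ℂ) * k y := by
    rw [PiLp.inner_apply]
    refine Finset.sum_congr rfl fun y _ => ?_
    have : (D y : ℂ) = (√(D y) : ℂ) * (√(D y) : ℂ) := by
      rw [← Complex.ofReal_mul, Real.mul_self_sqrt (hD.1 y)]
    simp [coherentEncoding, this]
    ring
  rw [reflect, h]
  simp [coherentEncoding]
  ring

/-- Rotation of the qubit by the angle with cosine `c x`, controlled by the workspace. -/
noncomputable def rotationGate [Fintype J] (c : Ω → ℝ) (hc : ∀ x, c x ^ 2 ≤ 1) (k : J → Bool) :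
    EuclideanSpace ℂ (Ω × Bool × J) ≃ₗᵢ[ℂ] EuclideanSpace ℂ (Ω × Bool × J) :=
  qubitGate
    (fun x j q q' => if k j then
        (if q = q' then c x else if q then -√(1 - c x ^ 2) else √(1 - c x ^ 2))
      else if q = q' then 1 else 0)
    (fun x j z => by
      by_cases hk : k j
      · have hs : √(1 - c x ^ 2) ^ 2 = 1 - c x ^ 2 := Real.sq_sqrt (by linarith [hc x])
        simp [hk, Complex.sq_norm, Complex.normSq_apply]
        linear_combination ((z true).re ^ 2 + (z true).im ^ 2 + (z false).re ^ 2 +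
          (z false).im ^ 2) * hs
      · simp [hk])

/-- Flip of the sign of the qubit state `|1⟩`, controlled by the workspace. -/
noncomputable def signGate [Fintype J] (k : J → Bool) :
    EuclideanSpace ℂ (Ω × Bool × J) ≃ₗᵢ[ℂ] EuclideanSpace ℂ (Ω × Bool × J) :=
  qubitGate (fun _ j q q' => if q = q' then (if q && k j then -1 else 1) else 0)
    (fun x j z => by by_cases hk : k j <;> simp [hk])

/-- The control of the reflection about `|ψ_D, 0⟩` that is itself controlled by `k`. -/
def qubitControl (k : J → Bool) : Bool × J → Bool := fun w => !w.1 && k w.2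

theorem rotationGate_apply [Fintype J] (c : Ω → ℝ) (hc : ∀ x, c x ^ 2 ≤ 1) (k : J → Bool)
    (v : EuclideanSpace ℂ (Ω × Bool × J)) (x : Ω) (q : Bool) (j : J) :
    rotationGate c hc k v (x, q, j) =
      if k j then
        if q then (c x : ℂ) * v (x, true, j) - (√(1 - c x ^ 2) : ℂ) * v (x, false, j)
        else (c x : ℂ) * v (x, false, j) + (√(1 - c x ^ 2) : ℂ) * v (x, true, j)
      else v (x, q, j) := by
  rw [rotationGate, qubitGate_apply]
  by_cases hk : k j <;> cases q <;> simp [hk]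
  · ring
  · ring

theorem signGate_apply [Fintype J] (k : J → Bool)
    (v : EuclideanSpace ℂ (Ω × Bool × J)) (x : Ω) (q : Bool) (j : J) :
    signGate k v (x, q, j) = if q && k j then -v (x, q, j) else v (x, q, j) := by
  rw [signGate, qubitGate_apply]
  by_cases hk : k j <;> cases q <;> simp [hk]

/-- The Grover iterate rotates the plane by the angle with cosine `mean D c`. -/
theorem groverStep_planeState [Fintype J] {D c : Ω → ℝ} (hD : D ∈ stdSimplex ℝ Ω)
    (hc : ∀ x, c x ^ 2 ≤ 1)
    (hm : mean D c ^ 2 < 1) (k : J → Bool) (a b : J → ℂ) :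
    controlledReflect (coherentEncoding D) (qubitControl k)
        (rotationGate c hc k (planeState D c a b)) =
      planeState D c
        (fun j => if k j then (mean D c : ℂ) * a j - (√(1 - mean D c ^ 2) : ℂ) * b j else a j)
        (fun j => if k j then (√(1 - mean D c ^ 2) : ℂ) * a j + (mean D c : ℂ) * b j else b j) := by
  have hC : 0 < 1 - mean D c ^ 2 := by linarith
  have hS : √(1 - mean D c ^ 2) ^ 2 = 1 - mean D c ^ 2 := Real.sq_sqrt hC.le
  have hS0 : √(1 - mean D c ^ 2) ≠ 0 := (Real.sqrt_pos.2 hC).ne'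
  have hs : ∀ x, √(1 - c x ^ 2) ^ 2 = 1 - c x ^ 2 := fun x => Real.sq_sqrt (by linarith [hc x])
  have hCdef : ∑ x, (D x : ℂ) * (c x : ℂ) = (mean D c : ℂ) := by simp [mean]
  have hD1 : ∑ x, (D x : ℂ) = 1 := by rw [← Complex.ofReal_sum, hD.2, Complex.ofReal_one]
  have hS0' : (√(1 - mean D c ^ 2) : ℂ) ≠ 0 := by exact_mod_cast hS0
  have hS' : (√(1 - mean D c ^ 2) : ℂ) ^ 2 = 1 - (mean D c : ℂ) ^ 2 := by exact_mod_cast hS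
  have hs' : ∀ x, (√(1 - c x ^ 2) : ℂ) ^ 2 = 1 - (c x : ℂ) ^ 2 := fun x => by
    exact_mod_cast hs x
  ext ⟨x, q, j⟩
  by_cases hk : k j
  swap
  · simp [controlledReflect, qubitControl, hk, rotationGate_apply, planeState]
  cases q
  -- On the |0⟩ slice the coefficient of b is (c(C - c) - (1 - c²))/S = (cC - 1)/S, where C is the
  -- mean and S = √(1 - C²).
  · have h : (WithLp.toLp 2 fun x => rotationGate c hc k (planeState D c a b) (x, false, j) :
        EuclideanSpace ℂ Ω) = WithLp.toLp 2 fun x => (√(D x) : ℂ) *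
          (c x * a j + (c x * mean D c - 1) / √(1 - mean D c ^ 2) * b j) := by
      ext y
      simp only [rotationGate_apply, hk, planeState, if_true, if_false, Bool.false_eq_true]
      push_cast
      field_simp
      linear_combination -(√(D y) : ℂ) * b j * hs' y
    have hsum : ∑ y, (D y : ℂ) *
        (c y * a j + (c y * mean D c - 1) / √(1 - mean D c ^ 2) * b j) =
        mean D c * a j - √(1 - mean D c ^ 2) * b j := by
      have : ∀ y, (D y : ℂ) *
        (c y * a j + (c y * mean D c - 1) / √(1 - mean D c ^ 2) * b j) =
        (D y * c y : ℂ) * (a j + mean D c / √(1 - mean D c ^ 2) * b j) -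
          D y * (1 / √(1 - mean D c ^ 2) * b j) := fun y => by ring
      simp only [this, Finset.sum_sub_distrib, ← Finset.sum_mul, hCdef, hD1]
      field_simp
      linear_combination b j * hS'
    simp only [controlledReflect, qubitControl, hk, Bool.not_false, Bool.and_true, if_true]
    rw [h, reflect_coherentEncoding_apply hD, hsum]
    simp only [hk, planeState, if_true, if_false, Bool.false_eq_true]
    push_cast
    field_simp
    linear_combination (-(√(D x) : ℂ) * b j) * hS'
  -- The control is off on |1⟩; the sign that the full reflection about |ψ_D, 0⟩ would give there is
  -- already part of the rotation.
  · simp only [controlledReflect, qubitControl, Bool.not_true, Bool.false_and,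
      rotationGate_apply, hk, planeState, if_true, if_false, Bool.false_eq_true]
    push_cast
    field_simp
    ring

/-- The controlled reflection about `|ψ_D, 0⟩` flips the sign of the other vector of the plane. -/
theorem signStep_planeState [Fintype J] {D c : Ω → ℝ} (hD : D ∈ stdSimplex ℝ Ω)
    (k : J → Bool) (a b : J → ℂ) :
    controlledReflect (coherentEncoding D) (qubitControl k) (signGate k (planeState D c a b)) =
      planeState D c a (fun j => if k j then -b j else b j) := by
  have hCdef : ∑ x, (D x : ℂ) * (c x : ℂ) = (mean D c : ℂ) := by simp [mean]
  have hD1 : ∑ x, (D x : ℂ) = 1 := by rw [← Complex.ofReal_sum, hD.2, Complex.ofReal_one]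
  ext ⟨x, q, j⟩
  by_cases hk : k j
  swap
  · simp [controlledReflect, qubitControl, hk, signGate_apply, planeState]
  cases q
  · have h : (WithLp.toLp 2 fun x => signGate k (planeState D c a b) (x, false, j) :
        EuclideanSpace ℂ Ω) = WithLp.toLp 2 fun x => (√(D x) : ℂ) *
          (a j + (mean D c - c x) / √(1 - mean D c ^ 2) * b j) := by
      ext y
      simp [signGate_apply, planeState]
      ring
    have hsum : ∑ y, (D y : ℂ) *
        (a j + (mean D c - c y) / √(1 - mean D c ^ 2) * b j) = a j := by
      have : ∀ y, (D y : ℂ) * (a j + (mean D c - c y) / √(1 - mean D c ^ 2) * b j) =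
        D y * (a j + mean D c / √(1 - mean D c ^ 2) * b j) -
          (D y * c y) * (1 / √(1 - mean D c ^ 2) * b j) := fun y => by ring
      simp only [this, Finset.sum_sub_distrib, ← Finset.sum_mul, hCdef, hD1]
      ring
    simp only [controlledReflect, qubitControl, hk, Bool.not_false, Bool.and_true, if_true]
    rw [h, reflect_coherentEncoding_apply hD, hsum]
    simp [hk, planeState]
    ring
  -- The control is off on |1⟩, so the minus sign of the reflection comes from `signGate`.
  · simp [controlledReflect, qubitControl, signGate_apply, hk, planeState]

end Plane

/-! ### Fourier transform on ℤ/t × ℤ/2 -/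

section Fourier

/-- The angle of the `y`-th point of the `t`-point grid on the circle. -/
noncomputable def gridAngle (t y : ℕ) : ℝ := 2 * Real.pi * y / t

/-- The discrete Fourier transform of the first `t` values of `v`, normalized to be unitary. -/
noncomputable def gridFourier (t : ℕ) (v : ℕ → ℂ) (y : ℕ) : ℂ :=
  ((√t)⁻¹ : ℝ) * ∑ j ∈ Finset.range t, Complex.exp (-(gridAngle t y * j : ℝ) * Complex.I) * v j

/-- A geometric sum whose ratio is a t-th root of unity. The ratio is 1 only if t divides z - y, and
|z - y| < t. -/
theorem sum_exp_grid {t : ℕ} (ht : t ≠ 0) (y z : Fin t) :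
    ∑ j ∈ Finset.range t, Complex.exp (((gridAngle t z - gridAngle t y) * j : ℝ) * Complex.I) =
      if y = z then (t : ℂ) else 0 := by
  have ht' : (t : ℂ) ≠ 0 := by exact_mod_cast ht
  split_ifs with h
  · simp [h]
  · set q := Complex.exp ((gridAngle t z - gridAngle t y : ℝ) * Complex.I) with hq
    have h1 : ∀ j : ℕ, Complex.exp (((gridAngle t z - gridAngle t y) * j : ℝ) * Complex.I) =
        q ^ j := fun j => by
      rw [hq, ← Complex.exp_nat_mul]
      congr 1
      push_cast
      ring
    have hqt : q ^ t = 1 := by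
      rw [hq, ← Complex.exp_nat_mul, Complex.exp_eq_one_iff]
      refine ⟨(z : ℤ) - (y : ℤ), ?_⟩
      simp only [gridAngle]
      push_cast
      field_simp
    have hq1 : q ≠ 1 := by
      intro hq1
      rw [hq, Complex.exp_eq_one_iff] at hq1
      obtain ⟨n, hn⟩ := hq1
      have h2 : (gridAngle t z - gridAngle t y : ℝ) = n * (2 * Real.pi) := by
        have := congrArg Complex.im hn
        simpa using this
      simp only [gridAngle] at h2
      have htR : (t : ℝ) ≠ 0 := by exact_mod_cast ht
      field_simp at h2
      have h3 : ((z : ℕ) : ℤ) - ((y : ℕ) : ℤ) = t * n := by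
        exact_mod_cast (by linarith : ((z : ℕ) : ℝ) - ((y : ℕ) : ℝ) = t * n)
      have hy := y.2
      have hz := z.2
      have : ((z : ℕ) : ℤ) - ((y : ℕ) : ℤ) = 0 := by
        apply Int.eq_zero_of_abs_lt_dvd ⟨n, h3⟩
        rw [abs_lt]; constructor <;> omega
      exact h (Fin.ext (by omega))
    simp only [h1]
    rw [geom_sum_eq hq1, hqt, sub_self, zero_div]

/-- The Fourier basis of the group `ℤ/t × ℤ/2`. -/
noncomputable def fourierVector (t : ℕ) (k : Fin t × Bool) : EuclideanSpace ℂ (Fin t × Bool) :=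
  WithLp.toLp 2 fun l => ((√(2 * t))⁻¹ : ℝ) *
    (Complex.exp ((gridAngle t k.1 * (l.1 : ℕ) : ℝ) * Complex.I) *
      if k.2 && l.2 then -1 else 1)

theorem inner_fourierVector (t : ℕ) (k : Fin t × Bool) (v : Fin t × Bool → ℂ) :
    inner ℂ (fourierVector t k) (WithLp.toLp 2 v) = ((√(2 * t))⁻¹ : ℝ) *
      ∑ j : Fin t, Complex.exp (-(gridAngle t k.1 * (j : ℕ) : ℝ) * Complex.I) *
        (v (j, false) + if k.2 then -v (j, true) else v (j, true)) := by
  rw [PiLp.inner_apply, Fintype.sum_prod_type, Finset.mul_sum]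
  refine Finset.sum_congr rfl fun j _ => ?_
  have h : (starRingEnd ℂ) (Complex.exp ((gridAngle t k.1 * (j : ℕ) : ℝ) * Complex.I)) =
      Complex.exp (-(gridAngle t k.1 * (j : ℕ) : ℝ) * Complex.I) := by
    rw [← Complex.exp_conj]; simp
  rw [Fintype.sum_bool]
  simp only [fourierVector, RCLike.inner_apply, map_mul, Complex.conj_ofReal, h]
  rcases k with ⟨y, s⟩
  cases s <;> simp <;> ring

theorem orthonormal_fourierVector {t : ℕ} (ht : t ≠ 0) : Orthonormal ℂ (fourierVector t) := by
  have ht' : (t : ℂ) ≠ 0 := by exact_mod_cast ht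
  rw [orthonormal_iff_ite]
  rintro ⟨y, s⟩ ⟨z, s'⟩
  have hsq : ((√(2 * t))⁻¹ : ℝ) * ((√(2 * t))⁻¹ : ℝ) = (2 * t : ℝ)⁻¹ := by
    rw [← mul_inv, Real.mul_self_sqrt (by positivity)]
  have hsqc : (((√(2 * t))⁻¹ : ℝ) : ℂ) * (((√(2 * t))⁻¹ : ℝ) : ℂ) = (2 * t : ℂ)⁻¹ := by
    rw [← Complex.ofReal_mul, hsq]; push_cast; rfl
  have key := sum_exp_grid ht y z
  rw [Finset.sum_range] at key
  have h0 : fourierVector t (z, s') = WithLp.toLp 2 (fourierVector t (z, s')).ofLp := rfl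
  rw [h0, inner_fourierVector]
  have h1 : ∀ j : Fin t, Complex.exp (-(gridAngle t y * (j : ℕ) : ℝ) * Complex.I) *
      (fourierVector t (z, s') (j, false) + if s then -fourierVector t (z, s') (j, true)
        else fourierVector t (z, s') (j, true)) =
      ((√(2 * t))⁻¹ : ℝ) * (if s = s' then 2 else 0) *
        Complex.exp (((gridAngle t z - gridAngle t y) * (j : ℕ) : ℝ) * Complex.I) := fun j => by
    have h2 : Complex.exp (((gridAngle t z - gridAngle t y) * (j : ℕ) : ℝ) * Complex.I) =
        Complex.exp (-(gridAngle t y * (j : ℕ) : ℝ) * Complex.I) *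
        Complex.exp ((gridAngle t z * (j : ℕ) : ℝ) * Complex.I) := by
      rw [← Complex.exp_add]; congr 1; push_cast; ring
    rw [h2]
    cases s <;> cases s' <;> simp [fourierVector] <;> ring
  simp only [h1, ← Finset.mul_sum, key]
  by_cases hs : s = s' <;> by_cases hy : y = z <;> simp only [hs, hy, if_true, if_false,
    Prod.mk.injEq, and_true, and_false, mul_zero, zero_mul]
  rw [← mul_assoc, ← mul_assoc, hsqc]
  field_simp

theorem exists_fourierBasis {t : ℕ} (ht : t ≠ 0) :
    ∃ b : OrthonormalBasis (Fin t × Bool) ℂ (EuclideanSpace ℂ (Fin t × Bool)),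
      ∀ k, b k = fourierVector t k := by
  obtain ⟨b, hb⟩ := Orthonormal.exists_orthonormalBasis_extension_of_card_eq (𝕜 := ℂ)
    (E := EuclideanSpace ℂ (Fin t × Bool)) (ι := Fin t × Bool) (by simp)
    (v := fourierVector t) (s := Set.univ)
    ((orthonormal_fourierVector ht).comp _ Subtype.val_injective)
  exact ⟨b, fun k => hb k trivial⟩

/-- The Fourier transform of the group `ℤ/t × ℤ/2`. -/
noncomputable def fourierUnitary {t : ℕ} (ht : t ≠ 0) :
    EuclideanSpace ℂ (Fin t × Bool) ≃ₗᵢ[ℂ] EuclideanSpace ℂ (Fin t × Bool) :=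
  (exists_fourierBasis ht).choose.repr

theorem fourierUnitary_apply {t : ℕ} (ht : t ≠ 0) (v : Fin t × Bool → ℂ) (k : Fin t × Bool) :
    fourierUnitary ht (WithLp.toLp 2 v) k = ((√(2 * t))⁻¹ : ℝ) *
      ∑ j : Fin t, Complex.exp (-(gridAngle t k.1 * (j : ℕ) : ℝ) * Complex.I) *
        (v (j, false) + if k.2 then -v (j, true) else v (j, true)) := by
  rw [fourierUnitary, OrthonormalBasis.repr_apply_apply, (exists_fourierBasis ht).choose_spec,
    inner_fourierVector]

/-- The ancilla splits the Fourier transform of `ℤ/t × ℤ/2`. -/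
theorem fourierUnitary_apply_ancilla {t : ℕ} (ht : t ≠ 0) (v : ℕ → ℂ) (s : Bool)
    (k : Fin t × Bool) :
    fourierUnitary ht (WithLp.toLp 2 fun l : Fin t × Bool =>
      ((√2)⁻¹ : ℝ) * if s && l.2 then -v l.1 else v l.1) k =
      if k.2 = s then gridFourier t v k.1 else 0 := by
  have h2 : ((√(2 * t))⁻¹ : ℝ) * ((√2)⁻¹ : ℝ) * 2 = (√t)⁻¹ := by
    have : √(2 : ℝ) * √2 = 2 := Real.mul_self_sqrt (by norm_num)
    have h3 : √(2 : ℝ) ≠ 0 := by positivity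
    have h4 : √(t : ℝ) ≠ 0 := by positivity
    rw [Real.sqrt_mul (by norm_num)]
    field_simp
    linarith
  have h2' : (((√(2 * t))⁻¹ : ℝ) : ℂ) * (((√2)⁻¹ : ℝ) : ℂ) * 2 = ((√t)⁻¹ : ℝ) := by
    rw [← h2]; push_cast; rfl
  rw [fourierUnitary_apply, gridFourier, Finset.sum_range, ← h2']
  rcases k with ⟨y, s'⟩
  cases s <;> cases s' <;> simp [Finset.mul_sum] <;>
    exact Finset.sum_congr rfl fun j _ => by ring

/-- Parseval, read off from the unitarity of `fourierUnitary` on a vector whose ancilla is in the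
state |+⟩. -/
theorem sum_norm_sq_gridFourier {t : ℕ} (ht : t ≠ 0) (v : ℕ → ℂ) :
    ∑ y : Fin t, ‖gridFourier t v y‖ ^ 2 = ∑ j ∈ Finset.range t, ‖v j‖ ^ 2 := by
  have h := (fourierUnitary ht).norm_map (WithLp.toLp 2 fun l : Fin t × Bool =>
      ((√2)⁻¹ : ℝ) * if false && l.2 then -v l.1 else v l.1)
  have h' := congrArg (· ^ 2) h
  simp only [EuclideanSpace.norm_sq_eq, Fintype.sum_prod_type, fourierUnitary_apply_ancilla,
    Fintype.sum_bool] at h'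
  rw [Finset.sum_range]
  simp [mul_pow] at h'
  rw [h']
  refine Finset.sum_congr rfl fun j _ => by ring

end Fourier

/-! ### The sine window and the flip probability -/

section Window

/-- The sine window on `{0, …, t - 1}`. -/
noncomputable def sineWindow (t j : ℕ) : ℝ := √(2 / t) * Real.sin (Real.pi * j / t)

theorem sineWindow_zero (t : ℕ) : sineWindow t 0 = 0 := by simp [sineWindow]

/-- Since the window vanishes at 0 and at t, summation by parts and cyclic shifts produce no
boundary terms. -/
theorem sineWindow_self {t : ℕ} (ht : t ≠ 0) : sineWindow t t = 0 := by
  have : (t : ℝ) ≠ 0 := by exact_mod_cast ht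
  simp [sineWindow, this]

theorem sineWindow_sq (t j : ℕ) :
    sineWindow t j ^ 2 = (1 - Real.cos (2 * Real.pi * j / t)) / t := by
  have h : (2 * Real.pi * j / t : ℝ) = 2 * (Real.pi * j / t) := by ring
  rw [sineWindow, mul_pow, Real.sq_sqrt (by positivity), h, Real.cos_two_mul, Real.sin_sq]
  ring

theorem sum_sineWindow_sq {t : ℕ} (ht : 2 ≤ t) :
    ∑ j ∈ Finset.range t, sineWindow t j ^ 2 = 1 := by
  have ht0 : (t : ℝ) ≠ 0 := by positivity
  -- The cosines sum to zero over a full period; this needs exp(2πi/t) ≠ 1, hence t ≥ 2.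
  have h := sum_exp_grid (t := t) (by omega) ⟨0, by omega⟩ ⟨1, by omega⟩
  rw [if_neg (by simp)] at h
  have h' := congrArg Complex.re h
  rw [Complex.re_sum] at h'
  have h2 : ∑ j ∈ Finset.range t, Real.cos (2 * Real.pi * j / t) = 0 := by
    rw [← Complex.zero_re, ← h']
    refine Finset.sum_congr rfl fun j _ => ?_
    rw [Complex.exp_ofReal_mul_I_re]
    simp only [gridAngle]
    congr 1
    push_cast
    ring
  simp only [sineWindow_sq]
  rw [← Finset.sum_div, Finset.sum_sub_distrib, h2]
  simp [ht0]

theorem sineWindow_succ_sub_sq_le {t : ℕ} (ht : t ≠ 0) (j : ℕ) :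
    (sineWindow t (j + 1) - sineWindow t j) ^ 2 ≤ 2 * Real.pi ^ 2 / t ^ 3 := by
  have ht0 : (0 : ℝ) < t := by exact_mod_cast Nat.pos_of_ne_zero ht
  have h := Real.abs_sin_sub_sin_le (Real.pi * (j + 1 : ℕ) / t) (Real.pi * j / t)
  have h1 : Real.pi * (j + 1 : ℕ) / t - Real.pi * j / t = Real.pi / t := by push_cast; ring
  rw [h1] at h
  have h2 := sq_le_sq' (by linarith [abs_nonneg (Real.pi / t), abs_le.1 h]) (abs_le.1 h).2
  rw [sq_abs] at h2
  calc (sineWindow t (j + 1) - sineWindow t j) ^ 2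
      = 2 / t * (Real.sin (Real.pi * (j + 1 : ℕ) / t) - Real.sin (Real.pi * j / t)) ^ 2 := by
        rw [sineWindow, sineWindow, ← mul_sub, mul_pow, Real.sq_sqrt (by positivity)]
    _ ≤ 2 / t * (Real.pi / t) ^ 2 := by gcongr
    _ = _ := by field_simp

theorem abs_sineWindow_sq_succ_sub_le {t : ℕ} (ht : t ≠ 0) (j : ℕ) :
    |sineWindow t (j + 1) ^ 2 - sineWindow t j ^ 2| ≤ 2 * Real.pi / t ^ 2 := by
  have ht0 : (0 : ℝ) < t := by exact_mod_cast Nat.pos_of_ne_zero ht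
  have h := Real.abs_cos_sub_cos_le (2 * Real.pi * j / t) (2 * Real.pi * (j + 1 : ℕ) / t)
  have h1 : 2 * Real.pi * j / t - 2 * Real.pi * (j + 1 : ℕ) / t = -(2 * Real.pi / t) := by
    push_cast; ring
  rw [h1, abs_neg, abs_of_nonneg (by positivity : 0 ≤ 2 * Real.pi / (t : ℝ))] at h
  rw [sineWindow_sq, sineWindow_sq, ← sub_div, abs_div, abs_of_pos ht0, div_le_iff₀ ht0]
  calc _ = |Real.cos (2 * Real.pi * j / t) - Real.cos (2 * Real.pi * (j + 1 : ℕ) / t)| := by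
        congr 1; ring
    _ ≤ 2 * Real.pi / t := h
    _ = _ := by field_simp

/-- Phase estimation with the sine window: the probability of measuring the phase `y` together
with the outcome `f` of the final test, `f` telling whether the state of the plane was flipped. -/
noncomputable def phaseWeight (t : ℕ) (φ : ℝ) (f : Bool) (y : ℕ) : ℝ :=
  ‖gridFourier t (fun j => (sineWindow t j *
    if f then Real.sin (j * φ) else Real.cos (j * φ) : ℝ)) y‖ ^ 2

theorem phaseWeight_nonneg (t : ℕ) (φ : ℝ) (f : Bool) (y : ℕ) : 0 ≤ phaseWeight t φ f y :=
  sq_nonneg _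

theorem sum_phaseWeight {t : ℕ} (ht : t ≠ 0) (φ : ℝ) (f : Bool) :
    ∑ y : Fin t, phaseWeight t φ f y = ∑ j ∈ Finset.range t, sineWindow t j ^ 2 *
      (if f then Real.sin (j * φ) else Real.cos (j * φ)) ^ 2 := by
  simp only [phaseWeight]
  rw [sum_norm_sq_gridFourier ht]
  refine Finset.sum_congr rfl fun j _ => ?_
  rw [Complex.norm_real, Real.norm_eq_abs, sq_abs, mul_pow]

theorem sum_phaseWeight_add {t : ℕ} (ht : 2 ≤ t) (φ : ℝ) :
    ∑ y : Fin t, (phaseWeight t φ false y + phaseWeight t φ true y) = 1 := by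
  rw [Finset.sum_add_distrib, sum_phaseWeight (by omega), sum_phaseWeight (by omega),
    ← Finset.sum_add_distrib, ← sum_sineWindow_sq ht]
  refine Finset.sum_congr rfl fun j _ => ?_
  rw [← mul_add]
  simp

/-- The state of the plane is flipped with constant probability. -/
theorem quarter_le_sum_phaseWeight_true {t : ℕ} (ht : 2 ≤ t) {φ : ℝ}
    (hφ : 2 * Real.pi ≤ t * Real.sin φ) : 1 / 4 ≤ ∑ y : Fin t, phaseWeight t φ true y := by
  have ht0 : (0 : ℝ) < t := by positivity
  have hs : 0 < Real.sin φ := by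
    by_contra h
    nlinarith [Real.pi_pos]
  rw [sum_phaseWeight (by omega)]
  -- The factor 4 sin φ turns the oscillating part of sin²(jφ) into a difference of consecutive
  -- sines, which suits summation by parts.
  have h1 : ∀ j : ℕ, 4 * Real.sin φ * (sineWindow t j ^ 2 * Real.sin (j * φ) ^ 2) =
      2 * Real.sin φ * sineWindow t j ^ 2 -
        (sineWindow t j ^ 2 * Real.sin ((2 * j + 1) * φ) -
          sineWindow t j ^ 2 * Real.sin ((2 * j - 1) * φ)) := fun j => by
    have e1 : (2 * j + 1) * φ = 2 * (j * φ) + φ := by ring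
    have e2 : (2 * j - 1) * φ = 2 * (j * φ) - φ := by ring
    rw [e1, e2, Real.sin_add, Real.sin_sub, Real.cos_two_mul, Real.cos_sq']
    ring
  have h2 : ∀ n : ℕ, ∑ j ∈ Finset.range n, (sineWindow t j ^ 2 * Real.sin ((2 * j + 1) * φ) -
      sineWindow t j ^ 2 * Real.sin ((2 * j - 1) * φ)) =
      sineWindow t n ^ 2 * Real.sin ((2 * n - 1) * φ) -
      ∑ j ∈ Finset.range n, (sineWindow t (j + 1) ^ 2 - sineWindow t j ^ 2) *
        Real.sin ((2 * j + 1) * φ) := by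
    intro n
    induction n with
    | zero => simp [sineWindow_zero]
    | succ n ih =>
      rw [Finset.sum_range_succ, Finset.sum_range_succ, ih]
      push_cast
      have : (2 * ((n : ℝ) + 1) - 1) * φ = (2 * n + 1) * φ := by ring
      rw [this]
      ring
  -- The total variation of the squared window is at most 2π/t, hence at most sin φ. So 4 sin φ
  -- times the sum is at least 2 sin φ - sin φ.
  have h3 : |∑ j ∈ Finset.range t, (sineWindow t (j + 1) ^ 2 - sineWindow t j ^ 2) *
        Real.sin ((2 * j + 1) * φ)| ≤ 2 * Real.pi / t := by
    calc _ ≤ ∑ j ∈ Finset.range t, |(sineWindow t (j + 1) ^ 2 - sineWindow t j ^ 2) *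
          Real.sin ((2 * j + 1) * φ)| := Finset.abs_sum_le_sum_abs _ _
      _ ≤ ∑ j ∈ Finset.range t, 2 * Real.pi / t ^ 2 := by
        refine Finset.sum_le_sum fun j _ => ?_
        rw [abs_mul]
        exact (mul_le_of_le_one_right (abs_nonneg _) (Real.abs_sin_le_one _)).trans
          (abs_sineWindow_sq_succ_sub_le (by omega) j)
      _ = _ := by
        rw [Finset.sum_const, Finset.card_range, nsmul_eq_mul]
        field_simp
  have h4 : 4 * Real.sin φ * ∑ j ∈ Finset.range t, sineWindow t j ^ 2 * Real.sin (j * φ) ^ 2 =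
      2 * Real.sin φ + ∑ j ∈ Finset.range t, (sineWindow t (j + 1) ^ 2 - sineWindow t j ^ 2) *
        Real.sin ((2 * j + 1) * φ) := by
    rw [Finset.mul_sum]
    simp only [h1]
    rw [Finset.sum_sub_distrib, h2, ← Finset.mul_sum, sum_sineWindow_sq ht,
      sineWindow_self (by omega)]
    ring
  have h5 : 2 * Real.pi / t ≤ Real.sin φ := by
    rw [div_le_iff₀ ht0]; linarith
  simp only [if_true]
  nlinarith [abs_le.1 h3]

end Window

/-! ### Accuracy of phase estimation -/

section PhaseTail

/-- Under the transform, multiplication by exp(-iθ_y) is a cyclic shift. Deviations of the measured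
angle from ψ thus become increments of v. -/
theorem one_sub_exp_mul_gridFourier {t : ℕ} (ht : t ≠ 0) (ψ : ℝ) (v : ℕ → ℂ) (y : Fin t) :
    (1 - Complex.exp (-(gridAngle t y - ψ : ℝ) * Complex.I)) * gridFourier t v y =
      gridFourier t (fun j => v j - Complex.exp (ψ * Complex.I) *
        v (if j = 0 then t - 1 else j - 1)) y := by
  obtain ⟨n, rfl⟩ := Nat.exists_eq_succ_of_ne_zero ht
  have h1 : Complex.exp (-(gridAngle (n + 1) y * (n + 1 : ℕ) : ℝ) * Complex.I) = 1 := by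
    rw [Complex.exp_eq_one_iff]
    refine ⟨-(y : ℤ), ?_⟩
    have : ((n + 1 : ℕ) : ℂ) ≠ 0 := by exact_mod_cast Nat.succ_ne_zero n
    simp only [gridAngle]
    push_cast at this ⊢
    field_simp
  have h2 : ∀ j : ℕ, Complex.exp (-(gridAngle (n + 1) y - ψ : ℝ) * Complex.I) *
      Complex.exp (-(gridAngle (n + 1) y * j : ℝ) * Complex.I) =
      Complex.exp (ψ * Complex.I) *
        Complex.exp (-(gridAngle (n + 1) y * (j + 1 : ℕ) : ℝ) * Complex.I) := fun j => by
    rw [← Complex.exp_add, ← Complex.exp_add]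
    congr 1
    push_cast
    ring
  have h3 : Complex.exp (-(gridAngle (n + 1) y - ψ : ℝ) * Complex.I) *
      ∑ j ∈ Finset.range (n + 1), Complex.exp (-(gridAngle (n + 1) y * j : ℝ) * Complex.I) * v j =
      ∑ j ∈ Finset.range (n + 1), Complex.exp (-(gridAngle (n + 1) y * j : ℝ) * Complex.I) *
        (Complex.exp (ψ * Complex.I) * v (if j = 0 then n + 1 - 1 else j - 1)) := by
    rw [Finset.mul_sum, Finset.sum_range_succ, Finset.sum_range_succ']
    simp only [← mul_assoc, h2, h1]
    simp [mul_comm]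
  simp only [gridFourier, Nat.succ_eq_add_one]
  rw [sub_mul, one_mul, mul_left_comm, h3, ← mul_sub, ← Finset.sum_sub_distrib]
  simp only [mul_sub]

theorem norm_sq_one_sub_exp (x : ℝ) :
    ‖1 - Complex.exp (-(x : ℝ) * Complex.I)‖ ^ 2 = 2 * (1 - Real.cos x) := by
  have : (-(x : ℂ)) * Complex.I = ((-x : ℝ) : ℂ) * Complex.I := by push_cast; rfl
  rw [this, Complex.sq_norm, Complex.normSq_apply]
  simp only [Complex.sub_re, Complex.sub_im, Complex.exp_ofReal_mul_I_re,
    Complex.exp_ofReal_mul_I_im, Complex.one_re, Complex.one_im, Real.cos_neg, Real.sin_neg]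
  nlinarith [Real.sin_sq_add_cos_sq x]

/-- The variance of phase estimation with the sine window. -/
theorem sum_one_sub_cos_mul_le {t : ℕ} (ht : 2 ≤ t) (ψ : ℝ) :
    ∑ y : Fin t, (1 - Real.cos (gridAngle t y - ψ)) *
      ‖gridFourier t (fun j => sineWindow t j * Complex.exp ((j * ψ : ℝ) * Complex.I)) y‖ ^ 2 ≤
      Real.pi ^ 2 / t ^ 2 := by
  have ht0 : (0 : ℝ) < t := by positivity
  set v : ℕ → ℂ := fun j => sineWindow t j * Complex.exp ((j * ψ : ℝ) * Complex.I) with hv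
  have h1 : ∀ y : Fin t, 2 * ((1 - Real.cos (gridAngle t y - ψ)) * ‖gridFourier t v y‖ ^ 2) =
      ‖gridFourier t (fun j => v j - Complex.exp (ψ * Complex.I) *
        v (if j = 0 then t - 1 else j - 1)) y‖ ^ 2 := fun y => by
    rw [← one_sub_exp_mul_gridFourier (by omega), norm_mul, mul_pow, norm_sq_one_sub_exp]
    ring
  have h2 : ∀ j ∈ Finset.range t, ‖v j - Complex.exp (ψ * Complex.I) *
      v (if j = 0 then t - 1 else j - 1)‖ ^ 2 ≤ 2 * Real.pi ^ 2 / t ^ 3 := by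
    intro j _
    rcases j with _ | j
    -- The shift wraps 0 around to t - 1. The modulus is still that of a window increment, the one
    -- from t - 1 to t, because the window is 0 both at 0 and at t.
    · have h := sineWindow_succ_sub_sq_le (t := t) (by omega) (t - 1)
      rw [Nat.sub_add_cancel (by omega), sineWindow_self (by omega)] at h
      simpa [hv, sineWindow_zero, Complex.norm_exp_ofReal_mul_I, ← Complex.ofReal_natCast,
        ← Complex.ofReal_mul] using h
    · have h := sineWindow_succ_sub_sq_le (t := t) (by omega) j
      have : v (j + 1) - Complex.exp (ψ * Complex.I) *
          v (if j + 1 = 0 then t - 1 else j + 1 - 1) =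
          ((sineWindow t (j + 1) - sineWindow t j : ℝ) : ℂ) *
            Complex.exp (((j + 1 : ℕ) * ψ : ℝ) * Complex.I) := by
        have e : Complex.exp (((j + 1 : ℕ) * ψ : ℝ) * Complex.I) =
            Complex.exp (ψ * Complex.I) * Complex.exp ((j * ψ : ℝ) * Complex.I) := by
          rw [← Complex.exp_add]; congr 1; push_cast; ring
        simp only [hv, e, Nat.add_eq_zero_iff, one_ne_zero, and_false, if_false,
          Nat.add_sub_cancel]
        push_cast
        ring
      rw [this, norm_mul, Complex.norm_exp_ofReal_mul_I, mul_one, Complex.norm_real,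
        Real.norm_eq_abs, sq_abs]
      exact h
  have h3 := sum_norm_sq_gridFourier (t := t) (by omega)
    fun j => v j - Complex.exp (ψ * Complex.I) * v (if j = 0 then t - 1 else j - 1)
  have h4 := Finset.sum_le_sum h2
  rw [← h3] at h4
  simp only [← h1, ← Finset.mul_sum] at h4
  rw [Finset.sum_const, Finset.card_range, nsmul_eq_mul] at h4
  have h5 : (t : ℝ) * (2 * Real.pi ^ 2 / t ^ 3) = 2 * (Real.pi ^ 2 / t ^ 2) := by field_simp
  linarith

/-- If p and q are the transforms of the cosine and sine parts, the amplitudes for the phases ±φ are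
p ± iq, and the parallelogram law applies. -/
theorem phaseWeight_add (t : ℕ) (φ : ℝ) (y : ℕ) :
    2 * (phaseWeight t φ false y + phaseWeight t φ true y) =
      ‖gridFourier t (fun j => sineWindow t j * Complex.exp ((j * φ : ℝ) * Complex.I)) y‖ ^ 2 +
      ‖gridFourier t (fun j => sineWindow t j * Complex.exp ((j * -φ : ℝ) * Complex.I)) y‖ ^ 2 := by
  set p := gridFourier t (fun j => (sineWindow t j * Real.cos (j * φ) : ℝ)) y with hp
  set q := gridFourier t (fun j => (sineWindow t j * Real.sin (j * φ) : ℝ)) y with hq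
  have h1 : gridFourier t (fun j => sineWindow t j * Complex.exp ((j * φ : ℝ) * Complex.I)) y =
      p + Complex.I * q := by
    rw [hp, hq]
    simp only [gridFourier, Finset.mul_sum, ← Finset.sum_add_distrib]
    refine Finset.sum_congr rfl fun j _ => ?_
    rw [Complex.exp_mul_I (x := ((j * φ : ℝ) : ℂ))]
    push_cast
    ring
  have h2 : gridFourier t (fun j => sineWindow t j * Complex.exp ((j * -φ : ℝ) * Complex.I)) y =
      p - Complex.I * q := by
    rw [hp, hq]
    simp only [gridFourier, Finset.mul_sum, ← Finset.sum_sub_distrib]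
    refine Finset.sum_congr rfl fun j _ => ?_
    rw [Complex.exp_mul_I (x := ((j * -φ : ℝ) : ℂ))]
    push_cast
    rw [mul_neg, Complex.cos_neg, Complex.sin_neg]
    ring
  rw [h1, h2]
  have h3 := parallelogram_law_with_norm ℝ p (Complex.I * q)
  simp only [norm_mul, Complex.norm_I, one_mul] at h3
  simp only [phaseWeight, if_true, if_false, Bool.false_eq_true, ← hp, ← hq]
  linarith

/-- An outcome of phase estimation is accurate if its angle is within `O(1/t)` of `±φ`. -/
def IsAccurate (t : ℕ) (φ : ℝ) (y : ℕ) : Prop :=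
  1 - Real.cos (gridAngle t y - φ) ≤ 16 * Real.pi ^ 2 / t ^ 2 ∨
    1 - Real.cos (gridAngle t y + φ) ≤ 16 * Real.pi ^ 2 / t ^ 2

open Classical in
-- Markov's inequality: the mean of 1 - cos of the deviation is at most π²/t² for each of the phases
-- ±φ, and an inaccurate outcome exceeds 16 times this bound for both.
theorem sum_phaseWeight_not_isAccurate_le {t : ℕ} (ht : 2 ≤ t) (φ : ℝ) :
    ∑ y : Fin t, (if IsAccurate t φ y then 0 else
      (phaseWeight t φ false y + phaseWeight t φ true y)) ≤ 1 / 16 := by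
  have ht0 : (0 : ℝ) < t := by positivity
  have hu : 0 < 16 * Real.pi ^ 2 / (t : ℝ) ^ 2 := by positivity
  have h1 := sum_one_sub_cos_mul_le ht φ
  have h2 := sum_one_sub_cos_mul_le ht (-φ)
  have key : 2 * (16 * Real.pi ^ 2 / (t : ℝ) ^ 2) * ∑ y : Fin t, (if IsAccurate t φ y then 0 else
      (phaseWeight t φ false y + phaseWeight t φ true y)) ≤
      Real.pi ^ 2 / t ^ 2 + Real.pi ^ 2 / t ^ 2 := by
    refine le_trans ?_ (add_le_add h1 h2)
    rw [Finset.mul_sum, ← Finset.sum_add_distrib]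
    refine Finset.sum_le_sum fun y _ => ?_
    have hn1 : 0 ≤ 1 - Real.cos (gridAngle t y - φ) := by
      linarith [Real.cos_le_one (gridAngle t y - φ)]
    have hn2 : 0 ≤ 1 - Real.cos (gridAngle t y - -φ) := by
      linarith [Real.cos_le_one (gridAngle t y - -φ)]
    split_ifs with h
    · rw [mul_zero]; positivity
    · rw [IsAccurate, not_or, not_le, not_le] at h
      rw [mul_comm 2, mul_assoc, phaseWeight_add, mul_add]
      rw [sub_neg_eq_add]
      gcongr
      · exact h.1.le
      · exact h.2.le
  have e : Real.pi ^ 2 / (t : ℝ) ^ 2 + Real.pi ^ 2 / t ^ 2 =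
    2 * (16 * Real.pi ^ 2 / (t : ℝ) ^ 2) * (1 / 16) := by ring
  rw [e] at key
  exact le_of_mul_le_mul_left key (by positivity)

/-- For a measured angle φ + d, cos φ - cos(φ + d) = sin d sin φ + cos φ (1 - cos d), and similarly
for -φ. Here 16π² < 160 and sin² d ≤ 2(1 - cos d) ≤ 320/t² < (18/t)². The factor sin φ makes the
error small for levels of small mean. -/
theorem abs_cos_sub_cos_le_of_isAccurate {t : ℕ} (ht : t ≠ 0) {φ : ℝ} (hφ : 0 ≤ Real.sin φ)
    {y : ℕ} (h : IsAccurate t φ y) :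
    |Real.cos φ - Real.cos (gridAngle t y)| ≤ 18 / t * Real.sin φ + 160 / t ^ 2 := by
  have ht0 : (0 : ℝ) < t := by exact_mod_cast Nat.pos_of_ne_zero ht
  have hpi : Real.pi ^ 2 < 10 := by nlinarith [Real.pi_lt_d2, Real.pi_pos]
  have main : ∀ d : ℝ, 1 - Real.cos d ≤ 16 * Real.pi ^ 2 / t ^ 2 →
      ∀ σ : ℝ, |σ| = Real.sin φ →
      |Real.cos φ - (Real.cos d * Real.cos φ - Real.sin d * σ)| ≤
        18 / t * Real.sin φ + 160 / t ^ 2 := by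
    intro d hd σ hσ
    have h1 : 16 * Real.pi ^ 2 / (t : ℝ) ^ 2 ≤ 160 / t ^ 2 := by gcongr; linarith
    have h2 : |Real.sin d| ≤ 18 / t := by
      apply abs_le_of_sq_le_sq _ (by positivity)
      have : Real.sin d ^ 2 ≤ 2 * (1 - Real.cos d) := by
        nlinarith [Real.sin_sq_add_cos_sq d, Real.cos_le_one d, Real.neg_one_le_cos d]
      have e : (18 / (t : ℝ)) ^ 2 = 2 * (162 / t ^ 2) := by ring
      have : (160 : ℝ) / t ^ 2 ≤ 162 / t ^ 2 := by gcongr; norm_num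
      rw [e]
      linarith
    have h3 : |Real.cos φ * (1 - Real.cos d)| ≤ 160 / t ^ 2 := by
      rw [abs_mul, abs_of_nonneg (sub_nonneg.2 (Real.cos_le_one d))]
      exact (mul_le_of_le_one_left (sub_nonneg.2 (Real.cos_le_one d))
        (Real.abs_cos_le_one φ)).trans (hd.trans h1)
    calc _ = |Real.sin d * σ + Real.cos φ * (1 - Real.cos d)| := by congr 1; ring
      _ ≤ |Real.sin d * σ| + |Real.cos φ * (1 - Real.cos d)| := abs_add_le _ _
      _ ≤ _ := by
        rw [abs_mul, hσ]
        gcongr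
  rcases h with h | h
  · have e : gridAngle t y = (gridAngle t y - φ) + φ := by ring
    rw [e, Real.cos_add]
    exact main _ h _ (abs_of_nonneg hφ)
  · have e : gridAngle t y = (gridAngle t y + φ) - φ := by ring
    have := main _ h (-Real.sin φ) (by rw [abs_neg, abs_of_nonneg hφ])
    rw [e, Real.cos_sub]
    rwa [mul_neg, sub_neg_eq_add] at this

end PhaseTail

/-! ### One round of phase estimation with a test of the state -/

section Round

variable {Ω : Type*} [Fintype Ω]

/-- The basis state of the workspace tensored with one of the two basis vectors of the plane. -/
noncomputable def branchState {J : Type*} [DecidableEq J] (D c : Ω → ℝ) (j₀ : J) (s : Bool) :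
    EuclideanSpace ℂ (Ω × Bool × J) :=
  planeState D c (if s then 0 else Pi.single j₀ 1) (if s then Pi.single j₀ 1 else 0)

/-- Apply the `j`-th power of the Grover iterate for `j ≤ n`, `j` being stored in the workspace. -/
noncomputable def groverPower {t : ℕ} (c : Ω → ℝ) (hc : ∀ x, c x ^ 2 ≤ 1)
    (A : QueryAlg Ω (Bool × Fin t × Bool)) : ℕ → QueryAlg Ω (Bool × Fin t × Bool)
  | 0 => A
  | n + 1 => .gate (rotationGate c hc fun l => decide (n < (l.1 : ℕ)))
      (.query (qubitControl fun l => decide (n < (l.1 : ℕ))) (groverPower c hc A n))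

theorem queries_groverPower {t : ℕ} (c : Ω → ℝ) (hc : ∀ x, c x ^ 2 ≤ 1)
    (A : QueryAlg Ω (Bool × Fin t × Bool)) (n : ℕ) :
    (groverPower c hc A n).queries = A.queries + n := by
  induction n with
  | zero => rfl
  | succ n ih => simp only [groverPower, QueryAlg.queries, ih]; ring

/-- The step with threshold n rotates only the clock values j > n, so the steps below n give clock
value j exactly min(j, n) rotations. -/
theorem prob_groverPower {t : ℕ} {D c : Ω → ℝ} (hD : D ∈ stdSimplex ℝ Ω)
    (hc : ∀ x, c x ^ 2 ≤ 1) (hm : mean D c ^ 2 < 1)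
    (P : ℝ → EuclideanSpace ℂ (Ω × Bool × Fin t × Bool) → Prop)
    (A : QueryAlg Ω (Bool × Fin t × Bool)) (n : ℕ) : ∀ a b : Fin t × Bool → ℂ,
    (groverPower c hc A n).prob (coherentEncoding D) P (planeState D c a b) =
      A.prob (coherentEncoding D) P (planeState D c
        (fun l => Real.cos ((min (l.1 : ℕ) n : ℕ) * Real.arccos (mean D c)) * a l -
          Real.sin ((min (l.1 : ℕ) n : ℕ) * Real.arccos (mean D c)) * b l)
        (fun l => Real.sin ((min (l.1 : ℕ) n : ℕ) * Real.arccos (mean D c)) * a l +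
          Real.cos ((min (l.1 : ℕ) n : ℕ) * Real.arccos (mean D c)) * b l)) := by
  have hm' := abs_lt.1 ((sq_lt_one_iff_abs_lt_one _).1 hm)
  have hcos : (mean D c : ℂ) = Real.cos (Real.arccos (mean D c)) := by
    rw [Real.cos_arccos hm'.1.le hm'.2.le]
  have hsin : (√(1 - mean D c ^ 2) : ℂ) = Real.sin (Real.arccos (mean D c)) := by
    rw [Real.sin_arccos]
  induction n with
  | zero => intro a b; simp [groverPower]
  | succ n ih =>
    intro a b
    simp only [groverPower, QueryAlg.prob]
    rw [groverStep_planeState hD hc hm, ih, hcos, hsin]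
    generalize Real.arccos (mean D c) = φ
    have hadd : ∀ j : ℕ, n < j → (min j (n + 1) : ℕ) * φ = (min j n : ℕ) * φ + φ := fun j hj => by
      rw [min_eq_right (by omega : n + 1 ≤ j), min_eq_right hj.le]
      push_cast
      ring
    congr 2 <;> funext l <;> by_cases hl : n < (l.1 : ℕ)
    · simp only [hl, decide_true, if_true]
      rw [hadd _ hl, Real.cos_add, Real.sin_add]
      push_cast
      ring
    · simp only [hl, decide_false, if_false, Bool.false_eq_true]
      rw [min_eq_left (by omega : (l.1 : ℕ) ≤ n), min_eq_left (by omega : (l.1 : ℕ) ≤ n + 1)]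
    · simp only [hl, decide_true, if_true]
      rw [hadd _ hl, Real.cos_add, Real.sin_add]
      push_cast
      ring
    · simp only [hl, decide_false, if_false, Bool.false_eq_true]
      rw [min_eq_left (by omega : (l.1 : ℕ) ≤ n), min_eq_left (by omega : (l.1 : ℕ) ≤ n + 1)]

/-- Measure the workspace `J`, reset it to the basis state `j₀`, and continue. -/
noncomputable def measureReset {J : Type*} [Fintype J] [DecidableEq J] (j₀ : J)
    (K : J → QueryAlg Ω (Bool × J)) : QueryAlg Ω (Bool × J) :=
  .measure (Fintype.card J) (fun p => Fintype.equivFin J p.2.2) fun i =>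
    .gate (workGate (moveUnitary (EuclideanSpace.single ((Fintype.equivFin J).symm i) 1)
      (EuclideanSpace.single j₀ 1) (by simp) (by simp))) (K ((Fintype.equivFin J).symm i))

theorem queries_measureReset_le {J : Type*} [Fintype J] [DecidableEq J] (j₀ : J)
    (K : J → QueryAlg Ω (Bool × J)) {N : ℕ} (hK : ∀ j, (K j).queries ≤ N) :
    (measureReset j₀ K).queries ≤ N :=
  Finset.sup_le fun _ _ => hK _

/-- Each basis state of the workspace is paired with only one vector of the plane, so measuring the
workspace collapses the plane too and leaves a classical mixture. -/
theorem prob_measureReset {J : Type*} [Fintype J] [DecidableEq J] {D c : Ω → ℝ} (j₀ : J)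
    {P : ℝ → EuclideanSpace ℂ (Ω × Bool × J) → Prop}
    (hP : ∀ r v (k : ℂ), k ≠ 0 → (P r (k • v) ↔ P r v)) (K : J → QueryAlg Ω (Bool × J))
    (a : J → ℂ) (s : J → Bool) :
    (measureReset j₀ K).prob (coherentEncoding D) P
        (planeState D c (fun j => if s j then 0 else a j) fun j => if s j then a j else 0) =
      ∑ j, ‖a j‖ ^ 2 * (K j).prob (coherentEncoding D) P (branchState D c j₀ (s j)) := by
  simp only [measureReset, QueryAlg.prob]
  rw [← (Fintype.equivFin J).sum_comp]
  refine Finset.sum_congr rfl fun j _ => ?_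
  rw [collapse_planeState D c (Fintype.equivFin J), workGate_planeState]
  simp only [Equiv.apply_eq_iff_eq, Equiv.symm_apply_apply]
  have h1 : ∀ z : ℂ, (WithLp.toLp 2 fun i => if i = j then z else 0 : EuclideanSpace ℂ J) =
      z • EuclideanSpace.single j 1 := fun z => by
    ext i; simp
  have h2 : (WithLp.toLp 2 fun i => if i = j then (if s i then 0 else a i) else 0 :
      EuclideanSpace ℂ J) = (if s j then 0 else a j) • EuclideanSpace.single j 1 := by
    rw [← h1]; ext i; by_cases h : i = j
    · subst h; simp
    · simp [h]
  have h3 : (WithLp.toLp 2 fun i => if i = j then (if s i then a i else 0) else 0 :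
      EuclideanSpace ℂ J) = (if s j then a j else 0) • EuclideanSpace.single j 1 := by
    rw [← h1]; ext i; by_cases h : i = j
    · subst h; simp
    · simp [h]
  rw [h2, h3, map_smul, map_smul, moveUnitary_apply, ← QueryAlg.prob_smul _ hP]
  congr 1
  rw [branchState, ← planeState_smul]
  congr 1
  · ext i; by_cases h : s j <;> simp [h, Pi.single_apply]
  · ext i; by_cases h : s j <;> simp [h, Pi.single_apply]

/-- The initial state of the clock and the ancilla in phase estimation. -/
noncomputable def windowState (t : ℕ) : EuclideanSpace ℂ (Fin t × Bool) :=
  WithLp.toLp 2 fun l => (((√2)⁻¹ * sineWindow t l.1 : ℝ) : ℂ)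

theorem norm_windowState {t : ℕ} (ht : 2 ≤ t) : ‖windowState t‖ = 1 := by
  rw [← sq_eq_sq₀ (norm_nonneg _) zero_le_one, EuclideanSpace.norm_sq_eq, Fintype.sum_prod_type,
    one_pow, ← sum_sineWindow_sq ht, Finset.sum_range]
  refine Finset.sum_congr rfl fun j _ => ?_
  rw [Fintype.sum_bool]
  simp only [windowState, Complex.norm_real, Real.norm_eq_abs, sq_abs, mul_pow, inv_pow]
  rw [Real.sq_sqrt (by norm_num)]
  ring

/-- One round of phase estimation, followed by a test whether the state is `|ψ_D, 0⟩`. -/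
noncomputable def phaseRound {t : ℕ} (ht : 2 ≤ t) (c : Ω → ℝ) (hc : ∀ x, c x ^ 2 ≤ 1)
    (K : Fin t × Bool → QueryAlg Ω (Bool × Fin t × Bool)) : QueryAlg Ω (Bool × Fin t × Bool) :=
  .gate (workGate (moveUnitary (EuclideanSpace.single (⟨0, by omega⟩, false) 1) (windowState t)
      (by simp) (norm_windowState ht)))
    (groverPower c hc
      (.gate (signGate Prod.snd) (.query (qubitControl Prod.snd)
        (.gate (workGate (fourierUnitary (by omega)))
          (measureReset (⟨0, by omega⟩, false) K)))) t)

theorem queries_phaseRound_le {t : ℕ} (ht : 2 ≤ t) (c : Ω → ℝ) (hc : ∀ x, c x ^ 2 ≤ 1)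
    (K : Fin t × Bool → QueryAlg Ω (Bool × Fin t × Bool)) {N : ℕ} (hK : ∀ j, (K j).queries ≤ N) :
    (phaseRound ht c hc K).queries ≤ N + 1 + t := by
  simp only [phaseRound, QueryAlg.queries, queries_groverPower]
  have := queries_measureReset_le (⟨0, by omega⟩, false) K hK
  omega

/-- A transition of a Markov chain on the two plane vectors. The sign step leaves the ancilla in |+⟩
next to |ψ_D, 0⟩ and puts it in |-⟩ next to the other vector, so the transform over ℤ/2 writes the
plane vector into `k.2`. A flip goes with the sine amplitudes, no flip with the cosines; the sign of
the sine for `s = true` has no effect on probabilities. -/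
theorem prob_phaseRound {t : ℕ} (ht : 2 ≤ t) {D c : Ω → ℝ} (hD : D ∈ stdSimplex ℝ Ω)
    (hc : ∀ x, c x ^ 2 ≤ 1) (hm : mean D c ^ 2 < 1)
    {P : ℝ → EuclideanSpace ℂ (Ω × Bool × Fin t × Bool) → Prop}
    (hP : ∀ r v (k : ℂ), k ≠ 0 → (P r (k • v) ↔ P r v))
    (K : Fin t × Bool → QueryAlg Ω (Bool × Fin t × Bool)) (s : Bool) :
    (phaseRound ht c hc K).prob (coherentEncoding D) P
        (branchState D c (⟨0, by omega⟩, false) s) =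
      ∑ k : Fin t × Bool, phaseWeight t (Real.arccos (mean D c)) (xor s k.2) k.1 *
        (K k).prob (coherentEncoding D) P (branchState D c (⟨0, by omega⟩, false) k.2) := by
  set φ := Real.arccos (mean D c) with hφ
  set p : ℕ → ℂ := fun j => (sineWindow t j * (if s then -Real.sin (j * φ) else Real.cos (j * φ)) :
    ℝ) with hp
  set q : ℕ → ℂ := fun j => (sineWindow t j * (if s then Real.cos (j * φ) else Real.sin (j * φ)) :
    ℝ) with hq
  have hprep : moveUnitary (EuclideanSpace.single ((⟨0, by omega⟩, false) : Fin t × Bool) 1)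
      (windowState t) (by simp) (norm_windowState ht)
      (WithLp.toLp 2 (Pi.single (⟨0, by omega⟩, false) 1)) = windowState t :=
    moveUnitary_apply _ _ _ _
  have hmin : ∀ l : Fin t × Bool, min (l.1 : ℕ) t = l.1 := fun l => min_eq_left l.1.2.le
  have hsum : ∀ l : Fin t × Bool, windowState t l =
      (((√2)⁻¹ : ℝ) : ℂ) * (sineWindow t l.1 : ℂ) := fun l => by simp [windowState]
  have hstart : (phaseRound ht c hc K).prob (coherentEncoding D) P
        (branchState D c (⟨0, by omega⟩, false) s) =
      (measureReset (⟨0, by omega⟩, false) K).prob (coherentEncoding D) P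
        (planeState D c
          (fourierUnitary (by omega) (WithLp.toLp 2 fun l : Fin t × Bool =>
            ((√2)⁻¹ : ℝ) * if false && l.2 then -p l.1 else p l.1))
          (fourierUnitary (by omega) (WithLp.toLp 2 fun l : Fin t × Bool =>
            ((√2)⁻¹ : ℝ) * if true && l.2 then -q l.1 else q l.1))) := by
    simp only [phaseRound, QueryAlg.prob]
    rw [branchState, workGate_planeState, prob_groverPower hD hc hm]
    simp only [QueryAlg.prob]
    rw [signStep_planeState hD, workGate_planeState]
    simp only [hmin, ← hφ]
    cases s
    · simp only [if_false, Bool.false_eq_true, hprep]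
      congr 5 <;> funext l <;> simp [hsum, hp, hq]
      · ring
      · split_ifs <;> ring
    · simp only [if_true, hprep]
      congr 5 <;> funext l <;> simp [hsum, hp, hq]
      · ring
      · split_ifs <;> ring
  rw [hstart]
  have hout := prob_measureReset (D := D) (c := c) (⟨0, by omega⟩, false) hP K
    (fun k => if k.2 then gridFourier t q k.1 else gridFourier t p k.1) Prod.snd
  convert hout using 2
  · congr 1
    · funext k
      rw [fourierUnitary_apply_ancilla]
      rcases k with ⟨y, _ | _⟩ <;> simp
    · funext k
      rw [fourierUnitary_apply_ancilla]
      rcases k with ⟨y, _ | _⟩ <;> simp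
  · rename_i k _
    congr 1
    have hneg : ∀ v : ℕ → ℂ, gridFourier t (fun j => -v j) k.1 = -gridFourier t v k.1 := by
      intro v; simp [gridFourier]
    rcases k with ⟨y, _ | _⟩ <;> cases s <;> simp [phaseWeight, hp, hq]
    have := hneg fun j => (sineWindow t j : ℂ) * Complex.sin (j * φ)
    simp only at this
    rw [this, norm_neg]

end Round

/-! ### Medians of lists -/

section Median

/-- The least entry m with at least half of the list below or equal to it. If fewer than half were
at least m, the next smaller entry would qualify as well. -/
theorem exists_median (l : List ℝ) : ∃ m : ℝ,
    l.length ≤ 2 * l.countP (fun v => decide (v ≤ m)) ∧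
      l.length ≤ 2 * l.countP (fun v => decide (m ≤ v)) := by
  classical
  rcases eq_or_ne l [] with rfl | hl
  · exact ⟨0, by simp⟩
  set S := l.toFinset.filter fun m => l.length ≤ 2 * l.countP (fun v => decide (v ≤ m)) with hS
  have hne : l.toFinset.Nonempty := List.toFinset_nonempty_iff l |>.2 hl
  have hSne : S.Nonempty := by
    obtain ⟨M, hM, hmax⟩ := l.toFinset.exists_max_image id hne
    refine ⟨M, Finset.mem_filter.2 ⟨hM, ?_⟩⟩
    rw [List.countP_eq_length.2]
    · omega
    · intro v hv
      simpa using hmax v (List.mem_toFinset.2 hv)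
  obtain ⟨m, hm, hmin⟩ := S.exists_min_image id hSne
  refine ⟨m, (Finset.mem_filter.1 hm).2, ?_⟩
  by_contra hlt
  have hsplit := List.length_eq_countP_add_countP (fun v => decide (m ≤ v)) (l := l)
  set T := l.toFinset.filter fun v => v < m with hT
  have hTne : T.Nonempty := by
    by_contra hem
    rw [Finset.not_nonempty_iff_eq_empty, Finset.filter_eq_empty_iff] at hem
    have : l.countP (fun v => decide (m ≤ v)) = l.length := List.countP_eq_length.2 fun v hv => by
      simpa using hem (List.mem_toFinset.2 hv)
    omega
  obtain ⟨m', hm', hmax⟩ := T.exists_max_image id hTne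
  have hm'' := Finset.mem_filter.1 hm'
  have hcount : l.countP (fun v => decide (¬decide (m ≤ v) = true)) ≤
      l.countP (fun v => decide (v ≤ m')) := by
    refine List.countP_mono_left fun v hv h => ?_
    simp only [decide_eq_true_eq, not_le] at h ⊢
    exact hmax v (Finset.mem_filter.2 ⟨List.mem_toFinset.2 hv, h⟩)
  have : m' ∈ S := Finset.mem_filter.2 ⟨hm''.1, by omega⟩
  exact absurd (hmin m' this) (not_le.2 hm''.2)

/-- A median of a list of real numbers. -/
noncomputable def listMedian (l : List ℝ) : ℝ := (exists_median l).choose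

/-- A median outside the interval would force at least half of the entries outside, on the same
side. -/
theorem abs_sub_listMedian_le {x e : ℝ} {l : List ℝ}
    (h : 2 * l.countP (fun v => decide (¬|x - v| ≤ e)) < l.length) : |x - listMedian l| ≤ e := by
  obtain ⟨h1, h2⟩ := (exists_median l).choose_spec
  change _ ≤ 2 * l.countP (fun v => decide (v ≤ listMedian l)) at h1
  change _ ≤ 2 * l.countP (fun v => decide (listMedian l ≤ v)) at h2
  by_contra hm
  rw [abs_le, not_and_or, not_le, not_le] at hm
  rcases hm with hm | hm
  · have : l.countP (fun v => decide (listMedian l ≤ v)) ≤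
        l.countP (fun v => decide (¬|x - v| ≤ e)) := List.countP_mono_left fun v _ hv => by
      simp only [decide_eq_true_eq] at hv ⊢
      intro h
      linarith [(abs_le.1 h).1]
    omega
  · have : l.countP (fun v => decide (v ≤ listMedian l)) ≤
        l.countP (fun v => decide (¬|x - v| ≤ e)) := List.countP_mono_left fun v _ hv => by
      simp only [decide_eq_true_eq] at hv ⊢
      intro h
      linarith [(abs_le.1 h).2]
    omega

end Median

/-! ### Median estimate and recovery of the state -/

section Estimator

variable {Ω : Type*} [Fintype Ω]

/-- Repeat rounds of phase estimation until the state `|ψ_D⟩` is restored, at most `n` times. -/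
noncomputable def recoverLoop {t : ℕ} (ht : 2 ≤ t) (c : Ω → ℝ) (hc : ∀ x, c x ^ 2 ≤ 1)
    (K : QueryAlg Ω (Bool × Fin t × Bool)) : ℕ → Bool → QueryAlg Ω (Bool × Fin t × Bool)
  | _, false => K
  -- Giving up: the output is arbitrary, as this branch is counted as a failure.
  | 0, true => .ret 0
  | n + 1, true => phaseRound ht c hc fun k => recoverLoop ht c hc K n k.2

/-- Collect `n` outcomes of phase estimation. -/
noncomputable def sampleLoop {t : ℕ} (ht : 2 ≤ t) (c : Ω → ℝ) (hc : ∀ x, c x ^ 2 ≤ 1)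
    (K : List ℕ → Bool → QueryAlg Ω (Bool × Fin t × Bool)) :
    ℕ → List ℕ → Bool → QueryAlg Ω (Bool × Fin t × Bool)
  | 0, l, s => K l s
  | n + 1, l, _ => phaseRound ht c hc fun k => sampleLoop ht c hc K n ((k.1 : ℕ) :: l) k.2

/-- Estimate the mean of `c` by the median of `R` outcomes of phase estimation, restore the state
and continue with the estimate. -/
noncomputable def meanEstimator {t : ℕ} (ht : 2 ≤ t) (c : Ω → ℝ) (hc : ∀ x, c x ^ 2 ≤ 1)
    (R : ℕ) (K : ℝ → QueryAlg Ω (Bool × Fin t × Bool)) : QueryAlg Ω (Bool × Fin t × Bool) :=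
  sampleLoop ht c hc (fun l s => recoverLoop ht c hc
    (K (listMedian (l.map fun y => Real.cos (gridAngle t y)))) (3 * R) s) R [] false

theorem queries_recoverLoop_le {t : ℕ} (ht : 2 ≤ t) (c : Ω → ℝ) (hc : ∀ x, c x ^ 2 ≤ 1)
    (K : QueryAlg Ω (Bool × Fin t × Bool)) (n : ℕ) :
    ∀ s, (recoverLoop ht c hc K n s).queries ≤ K.queries + n * (1 + t) := by
  induction n with
  | zero => intro s; cases s <;> simp [recoverLoop, QueryAlg.queries]
  | succ n ih =>
    intro s
    cases s
    · simp [recoverLoop]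
    · have := queries_phaseRound_le ht c hc _ fun k => ih k.2
      simp only [recoverLoop]
      linarith

theorem queries_sampleLoop_le {t : ℕ} (ht : 2 ≤ t) (c : Ω → ℝ) (hc : ∀ x, c x ^ 2 ≤ 1)
    {K : List ℕ → Bool → QueryAlg Ω (Bool × Fin t × Bool)} {N : ℕ}
    (hK : ∀ l s, (K l s).queries ≤ N) (n : ℕ) :
    ∀ l s, (sampleLoop ht c hc K n l s).queries ≤ N + n * (1 + t) := by
  induction n with
  | zero => intro l s; simpa [sampleLoop] using hK l s
  | succ n ih =>
    intro l s
    have := queries_phaseRound_le ht c hc _ fun k => ih ((k.1 : ℕ) :: l) k.2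
    simp only [sampleLoop]
    linarith

theorem queries_meanEstimator_le {t : ℕ} (ht : 2 ≤ t) (c : Ω → ℝ) (hc : ∀ x, c x ^ 2 ≤ 1)
    (R : ℕ) {K : ℝ → QueryAlg Ω (Bool × Fin t × Bool)} {N : ℕ} (hK : ∀ r, (K r).queries ≤ N) :
    (meanEstimator ht c hc R K).queries ≤ N + 4 * R * (1 + t) := by
  refine (queries_sampleLoop_le ht c hc (N := N + 3 * R * (1 + t)) (fun l s => ?_) R [] false).trans
    (by linarith)
  exact (queries_recoverLoop_le ht c hc _ _ s).trans (Nat.add_le_add_right (hK _) _)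

variable {t : ℕ} {D c : Ω → ℝ} {P : ℝ → EuclideanSpace ℂ (Ω × Bool × Fin t × Bool) → Prop}

/-- Each round from the wrong vector returns to |ψ_D, 0⟩ with probability at least 1/4, so n
failures in a row have probability at most (3/4)^n. -/
theorem le_prob_recoverLoop (ht : 2 ≤ t) (hD : D ∈ stdSimplex ℝ Ω)
    (hc : ∀ x, c x ^ 2 ≤ 1) (hm : mean D c ^ 2 < 1)
    (hφ : 2 * Real.pi ≤ t * √(1 - mean D c ^ 2))
    (hP : ∀ r v (k : ℂ), k ≠ 0 → (P r (k • v) ↔ P r v))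
    (K : QueryAlg Ω (Bool × Fin t × Bool)) (n : ℕ) (s : Bool) :
    (1 - (3 / 4 : ℝ) ^ n) *
        K.prob (coherentEncoding D) P (branchState D c (⟨0, by omega⟩, false) false) ≤
      (recoverLoop ht c hc K n s).prob (coherentEncoding D) P
        (branchState D c (⟨0, by omega⟩, false) s) := by
  rw [← Real.sin_arccos] at hφ
  set V := K.prob (coherentEncoding D) P (branchState D c (⟨0, by omega⟩, false) false) with hV
  have hV0 : 0 ≤ V := QueryAlg.prob_nonneg _ _ _ _
  cases s
  · have : (0 : ℝ) ≤ (3 / 4) ^ n := by positivity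
    have h : recoverLoop ht c hc K n false = K := by cases n <;> rfl
    rw [h, ← hV]
    nlinarith
  induction n with
  | zero => simpa using QueryAlg.prob_nonneg _ _ _ _
  | succ n ih =>
    have h : ∀ m, recoverLoop ht c hc K m false = K := fun m => by cases m <;> rfl
    simp only [recoverLoop]
    rw [prob_phaseRound ht hD hc hm hP, Fintype.sum_prod_type]
    simp only [Fintype.sum_bool, Bool.xor_true, Bool.xor_false, Bool.not_true, h, ← hV]
    rw [Finset.sum_add_distrib, ← Finset.sum_mul, ← Finset.sum_mul]
    have h1 := sum_phaseWeight_add ht (Real.arccos (mean D c))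
    have h2 := quarter_le_sum_phaseWeight_true ht hφ
    rw [Finset.sum_add_distrib] at h1
    have h3 : 0 ≤ ∑ y : Fin t, phaseWeight t (Real.arccos (mean D c)) false y :=
      Finset.sum_nonneg fun y _ => phaseWeight_nonneg _ _ _ _
    rw [eq_sub_of_add_eq h1] at h3 ⊢
    generalize ∑ y : Fin t, phaseWeight t (Real.arccos (mean D c)) true y = f at *
    have h4 : (0 : ℝ) ≤ (3 / 4) ^ n := by positivity
    have h5 := mul_le_mul_of_nonneg_left ih h3
    have h6 : (1 - f) * ((3 / 4) ^ n * V) ≤ 3 / 4 * ((3 / 4) ^ n * V) := by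
      gcongr; linarith
    rw [pow_succ]
    linarith

open Classical in
/-- The number of inaccurate outcomes of phase estimation. -/
noncomputable def inaccurateCount (t : ℕ) (φ : ℝ) (l : List ℕ) : ℕ :=
  l.countP fun y => decide (¬IsAccurate t φ y)

open Classical in
-- The exponential moment of one outcome: 1 + 15 · (1/16) ≤ 2, whatever the current plane vector.
theorem sum_phaseWeight_mul_le (ht : 2 ≤ t) (φ : ℝ) (s : Bool) :
    ∑ k : Fin t × Bool, phaseWeight t φ (xor s k.2) k.1 *
      (if IsAccurate t φ k.1 then 1 else 16) ≤ 2 := by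
  have h1 := sum_phaseWeight_add ht φ
  have h2 := sum_phaseWeight_not_isAccurate_le ht φ
  have h3 : ∑ k : Fin t × Bool, phaseWeight t φ (xor s k.2) k.1 *
      (if IsAccurate t φ k.1 then 1 else 16) =
      ∑ y : Fin t, (phaseWeight t φ false y + phaseWeight t φ true y) + 15 *
        ∑ y : Fin t, (if IsAccurate t φ y then 0 else
          (phaseWeight t φ false y + phaseWeight t φ true y)) := by
    rw [Finset.mul_sum, ← Finset.sum_add_distrib, Fintype.sum_prod_type]
    refine Finset.sum_congr rfl fun y _ => ?_
    rw [Fintype.sum_bool]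
    cases s <;> simp <;> split_ifs <;> ring
  rw [h3, h1]
  linarith

theorem sum_phaseWeight_xor (ht : 2 ≤ t) (φ : ℝ) (s : Bool) :
    ∑ k : Fin t × Bool, phaseWeight t φ (xor s k.2) k.1 = 1 := by
  rw [← sum_phaseWeight_add ht φ, Fintype.sum_prod_type]
  refine Finset.sum_congr rfl fun y _ => ?_
  rw [Fintype.sum_bool]
  cases s <;> simp [add_comm]

/-- A Chernoff bound by induction: 16^(inaccurate so far) · 2^(rounds left) / 4^R does not increase
in expectation. At the end it is at least 1 if half of the outcomes are inaccurate; at the start it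
is 2^(-R). No independence of rounds is required. -/
theorem le_prob_sampleLoop (ht : 2 ≤ t) (hD : D ∈ stdSimplex ℝ Ω)
    (hc : ∀ x, c x ^ 2 ≤ 1) (hm : mean D c ^ 2 < 1)
    (hP : ∀ r v (k : ℂ), k ≠ 0 → (P r (k • v) ↔ P r v))
    (K : List ℕ → Bool → QueryAlg Ω (Bool × Fin t × Bool)) (R : ℕ) {b : ℝ} (hb : 0 ≤ b)
    (hK : ∀ l s, l.length = R → 2 * inaccurateCount t (Real.arccos (mean D c)) l < R →
      b ≤ (K l s).prob (coherentEncoding D) P (branchState D c (⟨0, by omega⟩, false) s))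
    (n : ℕ) : ∀ l s, l.length + n = R →
    b * (1 - 16 ^ inaccurateCount t (Real.arccos (mean D c)) l * 2 ^ n / 4 ^ R) ≤
      (sampleLoop ht c hc K n l s).prob (coherentEncoding D) P
        (branchState D c (⟨0, by omega⟩, false) s) := by
  classical
  set φ := Real.arccos (mean D c) with hφ
  induction n with
  | zero =>
    intro l s hl
    by_cases hbad : 2 * inaccurateCount t φ l < R
    · refine le_trans ?_ (hK l s hl hbad)
      have : (0 : ℝ) ≤ 16 ^ inaccurateCount t φ l * 2 ^ 0 / 4 ^ R := by positivity
      nlinarith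
    · refine le_trans ?_ (QueryAlg.prob_nonneg _ _ _ _)
      apply mul_nonpos_of_nonneg_of_nonpos hb
      rw [sub_nonpos, one_le_div (by positivity), pow_zero, mul_one]
      calc (4 : ℝ) ^ R ≤ 4 ^ (2 * inaccurateCount t φ l) :=
            pow_le_pow_right₀ (by norm_num) (not_lt.1 hbad)
        _ = _ := by rw [pow_mul]; norm_num
  | succ n ih =>
    intro l s hl
    simp only [sampleLoop]
    rw [prob_phaseRound ht hD hc hm hP, ← hφ]
    have hcount : ∀ y : ℕ, (16 : ℝ) ^ inaccurateCount t φ (y :: l) =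
        16 ^ inaccurateCount t φ l * if IsAccurate t φ y then 1 else 16 := fun y => by
      by_cases h : IsAccurate t φ y
      · simp [inaccurateCount, h]
      · simp [inaccurateCount, h, pow_succ]
    calc _ ≤ b * (1 - 16 ^ inaccurateCount t φ l * 2 ^ n / 4 ^ R *
          ∑ k : Fin t × Bool, phaseWeight t φ (xor s k.2) k.1 *
            (if IsAccurate t φ k.1 then 1 else 16)) := by
          have h := mul_le_mul_of_nonneg_left (sum_phaseWeight_mul_le ht φ s)
            (by positivity : (0 : ℝ) ≤ 16 ^ inaccurateCount t φ l * 2 ^ n / 4 ^ R)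
          apply mul_le_mul_of_nonneg_left _ hb
          refine le_trans (le_of_eq ?_) (sub_le_sub_left h 1)
          ring
      _ = ∑ k : Fin t × Bool, phaseWeight t φ (xor s k.2) k.1 *
          (b * (1 - 16 ^ inaccurateCount t φ ((k.1 : ℕ) :: l) * 2 ^ n / 4 ^ R)) := by
          nth_rewrite 1 [← sum_phaseWeight_xor ht φ s]
          rw [Finset.mul_sum, ← Finset.sum_sub_distrib, Finset.mul_sum]
          refine Finset.sum_congr rfl fun k _ => ?_
          rw [hcount]
          ring
      _ ≤ _ := by
          refine Finset.sum_le_sum fun k _ => ?_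
          refine mul_le_mul_of_nonneg_left (ih _ _ ?_) (phaseWeight_nonneg _ _ _ _)
          simp only [List.length_cons]
          omega

/-- The estimator of the mean restores the state `|ψ_D⟩` and is accurate. -/
theorem le_prob_meanEstimator (ht : 2 ≤ t) (hD : D ∈ stdSimplex ℝ Ω)
    (hc : ∀ x, c x ^ 2 ≤ 1) (hm : mean D c ^ 2 < 1)
    (hφ : 2 * Real.pi ≤ t * √(1 - mean D c ^ 2))
    (hP : ∀ r v (k : ℂ), k ≠ 0 → (P r (k • v) ↔ P r v))
    (R : ℕ) (K : ℝ → QueryAlg Ω (Bool × Fin t × Bool)) {b : ℝ} (hb : 0 ≤ b)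
    (hK : ∀ r, |mean D c - r| ≤ 18 / t * √(1 - mean D c ^ 2) + 160 / t ^ 2 →
      b ≤ (K r).prob (coherentEncoding D) P (tensorState (coherentEncoding D)
        (EuclideanSpace.single (false, ⟨0, by omega⟩, false) 1))) :
    (1 - 2 * (1 / 2) ^ R) * b ≤ (meanEstimator ht c hc R K).prob (coherentEncoding D) P
      (tensorState (coherentEncoding D)
        (EuclideanSpace.single (false, ⟨0, by omega⟩, false) 1)) := by
  have hm' := abs_lt.1 ((sq_lt_one_iff_abs_lt_one _).1 hm)
  rw [← planeState_single D c] at hK ⊢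
  -- The reason for 3R recovery rounds: (3/4)³ = 27/64 ≤ 1/2.
  have hp : (3 / 4 : ℝ) ^ (3 * R) ≤ (1 / 2) ^ R := by
    rw [pow_mul]
    exact pow_le_pow_left₀ (by norm_num) (by norm_num) R
  have hp1 : (1 / 2 : ℝ) ^ R ≤ 1 := pow_le_one₀ (by norm_num) (by norm_num)
  have hp0 : (0 : ℝ) < (1 / 2) ^ R := by positivity
  have h := le_prob_sampleLoop (D := D) (c := c) ht hD hc hm hP
    (fun l s => recoverLoop ht c hc
      (K (listMedian (l.map fun y => Real.cos (gridAngle t y)))) (3 * R) s) R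
    (b := (1 - (1 / 2) ^ R) * b) (mul_nonneg (by linarith) hb) ?_ R [] false (by simp)
  · refine le_trans ?_ h
    have e : (16 : ℝ) ^ inaccurateCount t (Real.arccos (mean D c)) [] * 2 ^ R / 4 ^ R =
        (1 / 2) ^ R := by
      simp only [inaccurateCount, List.countP_nil, pow_zero, one_mul]
      rw [← div_pow]; norm_num
    rw [e]
    -- Sampling and recovery each fail with probability at most x = 2^(-R), and (1 - x)² ≥ 1 - 2x.
    nlinarith [mul_nonneg (sq_nonneg ((1 / 2 : ℝ) ^ R)) hb]
  · intro l s hl hbad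
    refine le_trans ?_ (le_prob_recoverLoop ht hD hc hm hφ hP _ (3 * R) s)
    refine mul_le_mul (by linarith) (hK _ ?_) hb
      (sub_nonneg.2 (pow_le_one₀ (by norm_num) (by norm_num)))
    apply abs_sub_listMedian_le
    rw [List.length_map, hl, List.countP_map]
    refine lt_of_le_of_lt (Nat.mul_le_mul_left 2 (List.countP_mono_left fun y _ hy => ?_)) hbad
    simp only [Function.comp_apply, decide_eq_true_eq] at hy ⊢
    intro hacc
    apply hy
    have := abs_cos_sub_cos_le_of_isAccurate (t := t) (φ := Real.arccos (mean D c)) (by omega)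
      (by rw [Real.sin_arccos]; positivity) hacc
    rwa [Real.cos_arccos hm'.1.le hm'.2.le, Real.sin_arccos] at this

end Estimator

/-! ### Dyadic levels and their combination -/

section Levels

/-- The part of `g` with values in `[2 ^ (l - 1), 2 ^ l)`, in `[0, 1)` if `l = 0`, divided by
`2 ^ l`. -/
noncomputable def dyadicPart {Ω : Type*} (g : Ω → ℝ) (l : ℕ) (x : Ω) : ℝ :=
  if g x < 2 ^ l ∧ (l = 0 ∨ 2 ^ l ≤ 2 * g x) then g x / 2 ^ l else 0

variable {Ω : Type*} {g : Ω → ℝ}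

theorem dyadicPart_nonneg (hg : ∀ x, 0 ≤ g x) (l : ℕ) (x : Ω) : 0 ≤ dyadicPart g l x := by
  have := hg x
  unfold dyadicPart
  split_ifs <;> positivity

theorem dyadicPart_le_one (g : Ω → ℝ) (l : ℕ) (x : Ω) : dyadicPart g l x ≤ 1 := by
  unfold dyadicPart
  split_ifs with h
  · rw [div_le_one (by positivity)]; exact h.1.le
  · exact zero_le_one

theorem sum_two_pow_mul_dyadicPart (g : Ω → ℝ) (n : ℕ) (x : Ω) :
    ∑ l ∈ Finset.range (n + 1), 2 ^ l * dyadicPart g l x = if g x < 2 ^ n then g x else 0 := by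
  induction n with
  | zero => simp [dyadicPart]
  | succ n ih =>
    have h2 : (2 : ℝ) ^ (n + 1) = 2 * 2 ^ n := by ring
    have h0 : (0 : ℝ) < 2 ^ n := by positivity
    rw [Finset.sum_range_succ, ih]
    simp only [dyadicPart, Nat.add_eq_zero_iff, one_ne_zero, and_false, false_or]
    by_cases h : g x < 2 ^ n
    · rw [if_pos h, if_neg (by rw [h2]; intro h'; linarith [h'.2]), if_pos (by linarith)]
      ring
    · by_cases h' : g x < 2 ^ (n + 1)
      · rw [if_neg h, if_pos ⟨h', by rw [h2]; linarith⟩, if_pos h']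
        field_simp
        ring
      · rw [if_neg h, if_neg (fun h'' => h' h''.1), if_neg h']
        ring

/-- At most one summand is nonzero. On a level l ≥ 1 it equals 2^l g ≤ 2g², because 2^l ≤ 2g there;
on level 0, g ≤ 2g² + 1. This converts the second moment bound into a bound on the level means. -/
theorem sum_four_pow_mul_dyadicPart_le (g : Ω → ℝ) (n : ℕ) (x : Ω) :
    ∑ l ∈ Finset.range (n + 1), 4 ^ l * dyadicPart g l x ≤ 2 * g x ^ 2 + 1 := by
  have key : ∑ l ∈ Finset.range (n + 1), 4 ^ l * dyadicPart g l x ≤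
      if g x < 2 ^ n then 2 * g x ^ 2 + 1 else 0 := by
    induction n with
    | zero =>
      simp only [zero_add, Finset.sum_range_one, pow_zero, one_mul, dyadicPart, true_or, and_true,
        div_one]
      split_ifs
      · nlinarith [sq_nonneg (g x - 1)]
      · exact le_rfl
    | succ n ih =>
      have h2 : (2 : ℝ) ^ (n + 1) = 2 * 2 ^ n := by ring
      have h0 : (0 : ℝ) < 2 ^ n := by positivity
      rw [Finset.sum_range_succ]
      refine (add_le_add_left ih _).trans ?_
      simp only [dyadicPart, Nat.add_eq_zero_iff, one_ne_zero, and_false, false_or]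
      by_cases h : g x < 2 ^ n
      · rw [if_pos h, if_neg (by rw [h2]; intro h'; linarith [h'.2]), if_pos (by linarith)]
        simp
      · by_cases h' : g x < 2 ^ (n + 1)
        · rw [if_neg h, if_pos ⟨h', by rw [h2]; linarith⟩, if_pos h']
          have h4 : (4 : ℝ) ^ (n + 1) = 2 ^ (n + 1) * 2 ^ (n + 1) := by
            rw [← mul_pow]; norm_num
          rw [h4, zero_add, mul_assoc, mul_div_cancel₀ _ (by positivity), h2]
          nlinarith
        · rw [if_neg h, if_neg (fun h'' => h' h''.1), if_neg h']
          simp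
  refine key.trans ?_
  split_ifs
  · exact le_rfl
  · positivity

/-- The cosines of the qubit rotations that encode the function `dyadicPart g l`. -/
noncomputable def levelCosine (g : Ω → ℝ) (t l : ℕ) (x : Ω) : ℝ :=
  1 - 40 / t ^ 2 - dyadicPart g l x / 2

theorem levelCosine_sq_le_one (hg : ∀ x, 0 ≤ g x) {t : ℕ} (ht : 9 ≤ t) (l : ℕ) (x : Ω) :
    levelCosine g t l x ^ 2 ≤ 1 := by
  have h9 : (9 : ℝ) ≤ t := by exact_mod_cast ht
  have h1 : (40 : ℝ) / t ^ 2 ≤ 1 / 2 := by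
    rw [div_le_div_iff₀ (by positivity) (by norm_num)]; nlinarith
  have h2 : (0 : ℝ) ≤ 40 / t ^ 2 := by positivity
  have h3 := dyadicPart_nonneg hg l x
  have h4 := dyadicPart_le_one g l x
  unfold levelCosine
  rw [sq_le_one_iff_abs_le_one, abs_le]
  constructor <;> linarith

variable [Fintype Ω] {D : Ω → ℝ}

theorem mean_dyadicPart_nonneg (hD : D ∈ stdSimplex ℝ Ω) (hg : ∀ x, 0 ≤ g x) (l : ℕ) :
    0 ≤ mean D (dyadicPart g l) :=
  Finset.sum_nonneg fun x _ => mul_nonneg (hD.1 x) (dyadicPart_nonneg hg l x)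

theorem mean_dyadicPart_le_one (hD : D ∈ stdSimplex ℝ Ω) (l : ℕ) :
    mean D (dyadicPart g l) ≤ 1 := by
  rw [← hD.2]
  exact Finset.sum_le_sum fun x _ => mul_le_of_le_one_right (hD.1 x) (dyadicPart_le_one g l x)

/-- The truncation error of the dyadic decomposition of the mean. -/
theorem abs_mean_sub_sum_dyadicPart_le (hD : D ∈ stdSimplex ℝ Ω) (hg : ∀ x, 0 ≤ g x)
    (h2 : secondMoment D g ≤ 1) (n : ℕ) :
    |mean D g - ∑ l ∈ Finset.range (n + 1), 2 ^ l * mean D (dyadicPart g l)| ≤ 1 / 2 ^ n := by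
  have h0 : (0 : ℝ) < 2 ^ n := by positivity
  have e : ∑ l ∈ Finset.range (n + 1), 2 ^ l * mean D (dyadicPart g l) =
      ∑ x, D x * (if g x < 2 ^ n then g x else 0) := by
    simp only [mean, Finset.mul_sum]
    rw [Finset.sum_comm]
    refine Finset.sum_congr rfl fun x _ => ?_
    rw [← sum_two_pow_mul_dyadicPart, Finset.mul_sum]
    exact Finset.sum_congr rfl fun l _ => by ring
  rw [e, mean, ← Finset.sum_sub_distrib, abs_of_nonneg]
  · rw [le_div_iff₀ h0, Finset.sum_mul]
    refine le_trans (Finset.sum_le_sum fun x _ => ?_) h2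
    rw [← mul_sub, mul_assoc]
    refine mul_le_mul_of_nonneg_left ?_ (hD.1 x)
    split_ifs with h
    · simp only [sub_self, zero_mul]; positivity
    -- Above the cut 2^n ≤ g, so g · 2^n ≤ g².
    · nlinarith [hg x]
  · refine Finset.sum_nonneg fun x _ => ?_
    rw [← mul_sub]
    refine mul_nonneg (hD.1 x) ?_
    split_ifs <;> simp [hg x]

/-- Cauchy–Schwarz over the n + 1 levels, with ∑ 4^l p_l ≤ 2 · 1 + 1. It costs the square root of
the number of levels, the half in the exponent 1.5. -/
theorem sum_two_pow_mul_sqrt_mean_dyadicPart_le (hD : D ∈ stdSimplex ℝ Ω) (hg : ∀ x, 0 ≤ g x)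
    (h2 : secondMoment D g ≤ 1) (n : ℕ) :
    ∑ l ∈ Finset.range (n + 1), 2 ^ l * √(mean D (dyadicPart g l)) ≤ √(3 * (n + 1)) := by
  apply Real.le_sqrt_of_sq_le
  refine (sq_sum_le_card_mul_sum_sq (s := Finset.range (n + 1))).trans ?_
  have h1 : ∀ l : ℕ, (2 ^ l * √(mean D (dyadicPart g l))) ^ 2 =
      4 ^ l * mean D (dyadicPart g l) := fun l => by
    rw [mul_pow, Real.sq_sqrt (mean_dyadicPart_nonneg hD hg l), ← pow_mul, mul_comm l, pow_mul]
    norm_num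
  have h3 : ∑ l ∈ Finset.range (n + 1), 4 ^ l * mean D (dyadicPart g l) ≤ 3 := by
    calc _ = ∑ x, D x * ∑ l ∈ Finset.range (n + 1), 4 ^ l * dyadicPart g l x := by
          simp only [mean, Finset.mul_sum]
          rw [Finset.sum_comm]
          exact Finset.sum_congr rfl fun x _ => Finset.sum_congr rfl fun l _ => by ring
      _ ≤ ∑ x, D x * (2 * g x ^ 2 + 1) := Finset.sum_le_sum fun x _ =>
          mul_le_mul_of_nonneg_left (sum_four_pow_mul_dyadicPart_le g n x) (hD.1 x)
      _ = 2 * secondMoment D g + 1 := by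
          simp only [secondMoment, Finset.mul_sum, mul_add, mul_one, Finset.sum_add_distrib, hD.2,
            mul_left_comm]
      _ ≤ 3 := by linarith
  simp only [h1, Finset.card_range]
  push_cast
  nlinarith [(Nat.cast_nonneg n : (0 : ℝ) ≤ n)]

theorem mean_levelCosine (hD : D ∈ stdSimplex ℝ Ω) (t l : ℕ) :
    mean D (levelCosine g t l) = 1 - 40 / t ^ 2 - mean D (dyadicPart g l) / 2 := by
  simp only [mean, levelCosine, mul_sub, Finset.sum_sub_distrib, ← Finset.sum_mul, hD.2, one_mul,
    mul_one, Finset.sum_div, mul_div_assoc]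

theorem mean_levelCosine_bounds (hD : D ∈ stdSimplex ℝ Ω) (hg : ∀ x, 0 ≤ g x) {t : ℕ} (ht : 9 ≤ t)
    (l : ℕ) : 0 ≤ mean D (levelCosine g t l) ∧ mean D (levelCosine g t l) ≤ 1 - 40 / t ^ 2 := by
  have h9 : (9 : ℝ) ≤ t := by exact_mod_cast ht
  have h1 : (40 : ℝ) / t ^ 2 ≤ 1 / 2 := by
    rw [div_le_div_iff₀ (by positivity) (by norm_num)]; nlinarith
  have h3 := mean_dyadicPart_nonneg hD hg l
  have h4 := mean_dyadicPart_le_one (g := g) hD l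
  rw [mean_levelCosine hD]
  constructor <;> linarith

theorem mean_levelCosine_sq_lt_one (hD : D ∈ stdSimplex ℝ Ω) (hg : ∀ x, 0 ≤ g x) {t : ℕ}
    (ht : 9 ≤ t) (l : ℕ) : mean D (levelCosine g t l) ^ 2 < 1 := by
  obtain ⟨h1, h2⟩ := mean_levelCosine_bounds hD hg ht l
  have h3 : (0 : ℝ) < 40 / t ^ 2 := by positivity
  rw [sq_lt_one_iff_abs_lt_one, abs_lt]
  constructor <;> linarith

/-- The purpose of the shift 40/t²: even for a level of mean zero, 1 - C² ≥ 1 - C ≥ 40/t² > (2π/t)²,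
where C is the mean cosine, so recovery works. -/
theorem two_pi_le_mul_sqrt (hD : D ∈ stdSimplex ℝ Ω) (hg : ∀ x, 0 ≤ g x) {t : ℕ}
    (ht : 9 ≤ t) (l : ℕ) : 2 * Real.pi ≤ t * √(1 - mean D (levelCosine g t l) ^ 2) := by
  obtain ⟨h1, h2⟩ := mean_levelCosine_bounds hD hg ht l
  have ht0 : (0 : ℝ) < t := by positivity
  have h3 : (0 : ℝ) < 40 / t ^ 2 := by positivity
  rw [← div_le_iff₀' ht0]
  apply Real.le_sqrt_of_sq_le
  have h4 : (2 * Real.pi / t) ^ 2 ≤ 40 / t ^ 2 := by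
    rw [div_pow]
    gcongr
    nlinarith [Real.pi_lt_d2, Real.pi_pos]
  nlinarith

/-- With C the mean cosine, 1 - C² ≤ 2(1 - C) = 80/t² + p_l ≤ (9/t + √p_l)². -/
theorem sqrt_one_sub_mean_levelCosine_sq_le (hD : D ∈ stdSimplex ℝ Ω) (hg : ∀ x, 0 ≤ g x) {t : ℕ}
    (ht : 9 ≤ t) (l : ℕ) :
    √(1 - mean D (levelCosine g t l) ^ 2) ≤ 9 / t + √(mean D (dyadicPart g l)) := by
  obtain ⟨h1, h2⟩ := mean_levelCosine_bounds hD hg ht l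
  have h3 := mean_dyadicPart_nonneg hD hg l
  have h4 : (0 : ℝ) ≤ 9 / t := by positivity
  rw [Real.sqrt_le_left (by positivity)]
  have h5 : (9 / (t : ℝ)) ^ 2 = 81 / t ^ 2 := by ring
  have h6 : (40 : ℝ) / t ^ 2 * 2 ≤ 81 / t ^ 2 := by
    rw [div_mul_eq_mul_div]; gcongr; norm_num
  have h7 : 0 ≤ 9 / t * √(mean D (dyadicPart g l)) := by positivity
  have h8 := mean_levelCosine (g := g) hD t l
  rw [add_sq, Real.sq_sqrt h3, h5]
  nlinarith

/-- Estimate the means of `n` functions one after the other, and sum up. -/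
noncomputable def levelLoop {t : ℕ} (ht : 2 ≤ t) (c : ℕ → Ω → ℝ) (hc : ∀ l x, c l x ^ 2 ≤ 1)
    (R : ℕ) (u : ℕ → ℝ → ℝ) : ℕ → ℝ → QueryAlg Ω (Bool × Fin t × Bool)
  | 0, z => .ret z
  | n + 1, z => meanEstimator ht (c n) (hc n) R fun r => levelLoop ht c hc R u n (z + u n r)

theorem queries_levelLoop_le {t : ℕ} (ht : 2 ≤ t) (c : ℕ → Ω → ℝ) (hc : ∀ l x, c l x ^ 2 ≤ 1)
    (R : ℕ) (u : ℕ → ℝ → ℝ) (n : ℕ) :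
    ∀ z, (levelLoop ht c hc R u n z).queries ≤ n * (4 * R * (1 + t)) := by
  induction n with
  | zero => intro z; simp [levelLoop, QueryAlg.queries]
  | succ n ih =>
    intro z
    have := queries_meanEstimator_le ht (c n) (hc n) R fun r => ih (z + u n r)
    simp only [levelLoop]
    linarith

/-- A successful level hands back exactly the initial product state, so success probabilities
multiply and errors add. -/
theorem le_prob_levelLoop {t : ℕ} (ht : 2 ≤ t) (hD : D ∈ stdSimplex ℝ Ω) {c : ℕ → Ω → ℝ}
    (hc : ∀ l x, c l x ^ 2 ≤ 1) (hm : ∀ l, mean D (c l) ^ 2 < 1)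
    (hφ : ∀ l, 2 * Real.pi ≤ t * √(1 - mean D (c l) ^ 2))
    {P : ℝ → EuclideanSpace ℂ (Ω × Bool × Fin t × Bool) → Prop}
    (hP : ∀ r v (k : ℂ), k ≠ 0 → (P r (k • v) ↔ P r v))
    (R : ℕ) (hR : 2 * (1 / 2 : ℝ) ^ R ≤ 1) {u : ℕ → ℝ → ℝ} {T e : ℕ → ℝ}
    (hu : ∀ l r, |mean D (c l) - r| ≤ 18 / t * √(1 - mean D (c l) ^ 2) + 160 / t ^ 2 →
      |T l - u l r| ≤ e l) (n : ℕ) :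
    ∀ z, (∀ z', |∑ l ∈ Finset.range n, T l + z - z'| ≤ ∑ l ∈ Finset.range n, e l →
      P z' (tensorState (coherentEncoding D)
        (EuclideanSpace.single (false, ⟨0, by omega⟩, false) 1))) →
    (1 - 2 * (1 / 2) ^ R) ^ n ≤ (levelLoop ht c hc R u n z).prob (coherentEncoding D) P
      (tensorState (coherentEncoding D)
        (EuclideanSpace.single (false, ⟨0, by omega⟩, false) 1)) := by
  induction n with
  | zero =>
    intro z hz
    have := hz z (by simp)
    simp only [levelLoop, QueryAlg.prob, if_pos this, norm_sq_tensorState_single hD, pow_zero]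
    exact le_rfl
  | succ n ih =>
    intro z hz
    rw [pow_succ']
    refine le_prob_meanEstimator ht hD (hc n) (hm n) (hφ n) hP R _
      (pow_nonneg (by linarith) n) fun r hr => ih _ fun z' hz' => hz z' ?_
    rw [Finset.sum_range_succ, Finset.sum_range_succ]
    calc _ = |(∑ l ∈ Finset.range n, T l + (z + u n r) - z') + (T n - u n r)| := by
          congr 1; ring
      _ ≤ _ := (abs_add_le _ _).trans (add_le_add hz' (hu n r hr))

end Levels

/-! ### Number of repetitions -/

section Parameters

theorem exists_repetitions {L η : ℝ} (hL : 1 ≤ L) (hη : 0 < η) (hη1 : η < 1) :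
    ∃ R : ℕ, 2 * L * (1 / 2 : ℝ) ^ R ≤ η ∧ (R : ℝ) ≤ 1 + 3 / 2 * Real.log (2 * L / η) := by
  have hx : 1 ≤ 2 * L / η := by rw [one_le_div hη]; linarith
  obtain ⟨m, hm1, hm2⟩ := exists_nat_pow_near hx (by norm_num : (1 : ℝ) < 2)
  refine ⟨m + 1, ?_, ?_⟩
  · rw [div_lt_iff₀ hη] at hm2
    rw [one_div, inv_pow, ← div_eq_mul_inv, div_le_iff₀ (by positivity)]
    linarith
  · have h := Real.log_le_log (by positivity) hm1
    rw [Real.log_pow] at h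
    have := Real.log_two_gt_d9
    push_cast
    nlinarith [(Nat.cast_nonneg m : (0 : ℝ) ≤ m)]

end Parameters

/-! ### Number of levels, error budget and query budget -/

section Parameters

theorem exists_level_count {X : ℝ} (hX : 1 < X) :
    ∃ n : ℕ, 2 * X ≤ 2 ^ n ∧ (2 : ℝ) ^ n ≤ 4 * X ∧ (n + 1 : ℝ) ≤ 3 + 3 / 2 * Real.log X := by
  obtain ⟨n, hn1, hn2⟩ := exists_nat_pow_near (by linarith : 1 ≤ 4 * X)
    (by norm_num : (1 : ℝ) < 2)
  refine ⟨n, by rw [pow_succ] at hn2; linarith, hn1, ?_⟩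
  have h := Real.log_le_log (by positivity) hn1
  have h4 : Real.log 4 = 2 * Real.log 2 := by
    rw [show (4 : ℝ) = 2 ^ 2 by norm_num, Real.log_pow]; norm_num
  rw [Real.log_pow, Real.log_mul (by norm_num) (by positivity), h4] at h
  have := Real.log_two_gt_d9
  have hX' := Real.log_pos hX
  by_contra hlt
  nlinarith

/-- The estimates of all levels together are accurate enough. -/
theorem level_error_le {X L N t : ℝ} (hX : 1 < X) (hL : 2 ≤ L) (hN : 2 * X ≤ N) (hN4 : N ≤ 4 * X)
    (ht : 200 * √L * X ≤ t) :
    1 / N + (644 * (2 * N) / t ^ 2 + 36 / t * √(3 * L)) ≤ 1 / X := by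
  have hX0 : 0 < X := by linarith
  have hL0 : 0 < √L := Real.sqrt_pos.2 (by linarith)
  have ht0 : 0 < t := lt_of_lt_of_le (by positivity) ht
  -- Shares of the error 1/X: truncation 1/2, the 1/t² terms 1/10, the √p_l terms 36/100.
  have h1 : 1 / N ≤ 1 / 2 * (1 / X) := by
    rw [div_mul_div_comm, one_mul]
    exact one_div_le_one_div_of_le (by positivity) hN
  have h2 : 644 * (2 * N) / t ^ 2 ≤ 1 / 10 * (1 / X) := by
    have : (200 * √L * X) ^ 2 ≤ t ^ 2 := by gcongr
    rw [mul_pow, mul_pow, Real.sq_sqrt (by linarith)] at this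
    rw [div_mul_div_comm, one_mul, div_le_div_iff₀ (by positivity) (by positivity)]
    nlinarith [mul_pos hX0 hX0]
  have h3 : 36 / t * √(3 * L) ≤ 36 / 100 * (1 / X) := by
    have h3' : √(3 : ℝ) ≤ 2 := by
      rw [Real.sqrt_le_left (by norm_num)]; norm_num
    rw [Real.sqrt_mul (by norm_num), div_mul_eq_mul_div, div_mul_div_comm,
      div_le_div_iff₀ ht0 (by positivity)]
    nlinarith [mul_pos hL0 hX0]
  have : 0 < 1 / X := by positivity
  linarith

theorem query_count_le {X L Λ Y R t : ℝ} (hX : 1 < X) (hL : 2 ≤ L) (hLΛ : L ≤ 5 * Λ)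
    (hY : 1 / 5 ≤ Y) (hR : R ≤ 75 * Y) (ht0 : 0 ≤ t)
    (ht : t ≤ 200 * √L * X + 1) :
    L * (4 * R * (1 + t)) ≤ 1000000 * (X * Λ ^ (1.5 : ℝ) * Y) := by
  have hΛ : 0 < Λ := by linarith
  have h1 : (1 : ℝ) ≤ √L := Real.one_le_sqrt.2 (by linarith)
  have h2 : √L ≤ 3 * √Λ := by
    rw [Real.sqrt_le_left (by positivity), mul_pow, Real.sq_sqrt hΛ.le]
    linarith
  have h3 : Λ ^ (1.5 : ℝ) = Λ * √Λ := by
    rw [show (1.5 : ℝ) = 1 + 1 / 2 by norm_num, Real.rpow_add hΛ, Real.rpow_one,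
      Real.sqrt_eq_rpow]
  have h4 : 1 + t ≤ 202 * √L * X := by nlinarith
  have h5 : L * √L ≤ 15 * (Λ * √Λ) := by
    calc L * √L ≤ 5 * Λ * (3 * √Λ) := by gcongr
      _ = _ := by ring
  rw [h3]
  calc L * (4 * R * (1 + t)) ≤ L * (4 * (75 * Y) * (202 * √L * X)) := by gcongr
    _ = 60600 * (L * √L) * (Y * X) := by ring
    _ ≤ 60600 * (15 * (Λ * √Λ)) * (Y * X) := by gcongr
    _ ≤ 1000000 * (X * (Λ * √Λ) * Y) := by
      have : 0 ≤ Λ * √Λ * (Y * X) := by positivity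
      linarith

end Parameters

/-! ### Assembly of the algorithm -/

section Main

variable {Ω : Type*} [Fintype Ω]

/-- Solving the affine relation between mean cosine and p_l for p_l doubles the error; 644 = 2(18 ·
9 + 160). -/
theorem abs_dyadic_estimate_le {D g : Ω → ℝ} (hD : D ∈ stdSimplex ℝ Ω) (hg : ∀ x, 0 ≤ g x) {t : ℕ}
    (ht : 9 ≤ t) (l : ℕ) {r : ℝ}
    (hr : |mean D (levelCosine g t l) - r| ≤
      18 / t * √(1 - mean D (levelCosine g t l) ^ 2) + 160 / t ^ 2) :
    |mean D (dyadicPart g l) - 2 * (1 - 40 / t ^ 2 - r)| ≤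
      644 / t ^ 2 + 36 / t * √(mean D (dyadicPart g l)) := by
  have ht0 : (0 : ℝ) < t := by positivity
  have h1 : mean D (dyadicPart g l) - 2 * (1 - 40 / t ^ 2 - r) =
      -2 * (mean D (levelCosine g t l) - r) := by
    rw [mean_levelCosine hD]; ring
  have h2 := mul_le_mul_of_nonneg_left (sqrt_one_sub_mean_levelCosine_sq_le hD hg ht l)
    (by positivity : (0 : ℝ) ≤ 18 / t)
  have h3 : 18 / (t : ℝ) * (9 / t + √(mean D (dyadicPart g l))) =
      162 / t ^ 2 + 18 / t * √(mean D (dyadicPart g l)) := by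
    field_simp; ring
  have h4 : (644 : ℝ) / t ^ 2 = 2 * (162 / t ^ 2 + 160 / t ^ 2) := by ring
  rw [h1, abs_mul, h4]
  norm_num
  have h5 : 36 / (t : ℝ) * √(mean D (dyadicPart g l)) =
    2 * (18 / t * √(mean D (dyadicPart g l))) := by ring
  rw [h5]
  linarith

theorem mean_le_sqrt_secondMoment {D : Ω → ℝ} (hD : D ∈ stdSimplex ℝ Ω) (f : Ω → ℝ) :
    mean D f ≤ √(secondMoment D f) := by
  apply Real.le_sqrt_of_sq_le
  have h : 0 ≤ ∑ x, D x * (f x - mean D f) ^ 2 :=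
    Finset.sum_nonneg fun x _ => mul_nonneg (hD.1 x) (sq_nonneg _)
  have e : ∑ x, D x * (f x - mean D f) ^ 2 = secondMoment D f - mean D f ^ 2 := by
    have : ∀ x, D x * (f x - mean D f) ^ 2 =
        D x * f x ^ 2 - 2 * mean D f * (D x * f x) + mean D f ^ 2 * D x := fun x => by ring
    simp only [this, Finset.sum_add_distrib, Finset.sum_sub_distrib, ← Finset.mul_sum, hD.2]
    change secondMoment D f - 2 * mean D f * mean D f + mean D f ^ 2 * 1 = _
    ring
  linarith

end Main

theorem lemmaC4 :
    ∃ C : ℝ, 0 < C ∧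
      ∀ (Ω : Type*) [Fintype Ω] (f : Ω → ℝ) (B ε η : ℝ),
        (∀ x, 0 ≤ f x) → 1 ≤ B → 0 < ε → 0 < η → η < 1 →
        ∃ (W : Type) (_ : Fintype W) (_ : DecidableEq W) (w₀ : W) (A : QueryAlg Ω W),
          (A.queries : ℝ) ≤
            C * (Real.sqrt B / ε * Real.log (Real.exp 1 + B / ε) ^ (1.5 : ℝ) *
              Real.log (Real.log (Real.exp 1 + B / ε) / η)) ∧
          ∀ D ∈ stdSimplex ℝ Ω, secondMoment D f ≤ B →
            -- the output is an estimate of the mean with additive error `ε`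
            1 - η ≤ A.prob (coherentEncoding D) (fun r _ => |mean D f - r| ≤ ε)
              (tensorState (coherentEncoding D) (EuclideanSpace.single w₀ 1)) ∧
            -- the register `Ω` is left in the state `|ψ_D⟩`, unentangled with the workspace
            1 - η ≤ A.prob (coherentEncoding D)
              (fun _ v => ∃ χ : EuclideanSpace ℂ W, v = tensorState (coherentEncoding D) χ)
              (tensorState (coherentEncoding D) (EuclideanSpace.single w₀ 1)) := by
  refine ⟨1000000, by norm_num, ?_⟩
  intro Ω _ f B ε η hf hB hε hη hη1
  have hB0 : 0 < B := by linarith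
  have hBε : 0 < B / ε := by positivity
  set Λ := Real.log (Real.exp 1 + B / ε) with hΛ
  have hΛ1 : 1 ≤ Λ := by
    rw [hΛ, Real.le_log_iff_exp_le (by positivity)]; linarith
  -- Here 0 ≤ μ ≤ √φ ≤ √B ≤ ε, so the output 0 without any query is accurate.
  by_cases hlarge : √B ≤ ε
  · refine ⟨Unit, inferInstance, inferInstance, (), .ret 0, ?_, fun D hD hφ => ?_⟩
    · have : 0 ≤ Real.log (Λ / η) := Real.log_nonneg (by rw [one_le_div hη]; linarith)
      have : 0 ≤ Λ ^ (1.5 : ℝ) := by positivity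
      simp only [QueryAlg.queries, Nat.cast_zero]
      positivity
    · have h0 : 0 ≤ mean D f := Finset.sum_nonneg fun x _ => mul_nonneg (hD.1 x) (hf x)
      have h1 : mean D f ≤ ε :=
        (mean_le_sqrt_secondMoment hD f).trans ((Real.sqrt_le_sqrt hφ).trans hlarge)
      constructor
      · simp only [QueryAlg.prob]
        rw [if_pos (by rwa [sub_zero, abs_of_nonneg h0]), norm_sq_tensorState_single hD]
        linarith
      · simp only [QueryAlg.prob]
        rw [if_pos ⟨_, rfl⟩, norm_sq_tensorState_single hD]
        linarith
  · rw [not_le] at hlarge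
    have hsB : 0 < √B := Real.sqrt_pos.2 hB0
    have hX : 1 < √B / ε := by rwa [one_lt_div hε]
    have hsBB : √B ≤ B := by
      rw [Real.sqrt_le_left hB0.le]; nlinarith
    have hXB : √B / ε ≤ B / ε := by gcongr
    have hlogX : Real.log (√B / ε) ≤ Λ :=
      Real.log_le_log (by positivity) (by linarith [Real.exp_pos 1])
    -- A lower bound away from 0, so that additive constants in R are absorbed. Since B/ε > 1, Λ ≥
    -- log(e + 1) ≥ 1 + 1/(e + 1) ≥ 5/4, and log(5/4) ≥ 1/5.
    have hY : 1 / 5 ≤ Real.log (Λ / η) := by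
      have hΛ2 : 5 / 4 ≤ Λ := by
        have h1 : Real.exp 1 * (1 + 1 / Real.exp 1) ≤ Real.exp 1 + B / ε := by
          rw [mul_add, mul_one_div_cancel (Real.exp_pos 1).ne']; linarith
        have h2 := Real.log_le_log (by positivity) h1
        rw [Real.log_mul (Real.exp_pos 1).ne' (by positivity), Real.log_exp] at h2
        have h3 := Real.one_sub_inv_le_log_of_pos (by positivity : 0 < 1 + 1 / Real.exp 1)
        have h4 : 1 - (1 + 1 / Real.exp 1)⁻¹ = 1 / (Real.exp 1 + 1) := by
          field_simp; ring
        have h5 : 1 / 4 ≤ 1 / (Real.exp 1 + 1) :=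
          one_div_le_one_div_of_le (by positivity) (by linarith [Real.exp_one_lt_d9])
        linarith
      have h1 : 5 / 4 ≤ Λ / η := by
        rw [le_div_iff₀ hη]; nlinarith
      have h2 := Real.log_le_log (by norm_num) h1
      have h3 := Real.one_sub_inv_le_log_of_pos (by norm_num : (0 : ℝ) < 5 / 4)
      norm_num at h3
      linarith
    obtain ⟨n, hn1, hn2, hn3⟩ := exists_level_count hX
    have hL2 : (2 : ℝ) ≤ n + 1 := by
      have : 1 ≤ n := by
        by_contra h
        obtain rfl : n = 0 := by omega
        norm_num at hn1
        linarith
      have : (1 : ℝ) ≤ n := by exact_mod_cast this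
      linarith
    have hL5 : (n + 1 : ℝ) ≤ 5 * Λ := by linarith
    obtain ⟨R, hR1, hR2⟩ := exists_repetitions (by linarith : (1 : ℝ) ≤ n + 1) hη hη1
    have hR3 : (R : ℝ) ≤ 75 * Real.log (Λ / η) := by
      have h1 : 2 * (n + 1 : ℝ) / η ≤ 10 * (Λ / η) := by
        rw [mul_div_assoc', div_le_div_iff_of_pos_right hη]; linarith
      have h2 := Real.log_le_log (by positivity) h1
      rw [Real.log_mul (by norm_num) (by positivity)] at h2
      have h3 := Real.log_le_sub_one_of_pos (by norm_num : (0 : ℝ) < 10)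
      linarith
    set t := ⌈200 * √(n + 1 : ℝ) * (√B / ε)⌉₊ with htdef
    have ht1 : 200 * √(n + 1 : ℝ) * (√B / ε) ≤ t := Nat.le_ceil _
    have ht2 : (t : ℝ) ≤ 200 * √(n + 1 : ℝ) * (√B / ε) + 1 :=
      (Nat.ceil_lt_add_one (by positivity)).le
    have ht9 : 9 ≤ t := by
      have h1 : (1 : ℝ) ≤ √(n + 1 : ℝ) := Real.one_le_sqrt.2 (by linarith)
      have : (9 : ℝ) ≤ t := by nlinarith
      exact_mod_cast this
    have ht : 2 ≤ t := by omega
    clear_value t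
    set g : Ω → ℝ := fun x => f x / √B with hg
    have hg0 : ∀ x, 0 ≤ g x := fun x => div_nonneg (hf x) hsB.le
    refine ⟨Bool × Fin t × Bool, inferInstance, inferInstance, (false, ⟨0, by omega⟩, false),
      levelLoop ht (levelCosine g t) (fun l => levelCosine_sq_le_one hg0 ht9 l) R
        (fun l r => √B * (2 ^ l * (2 * (1 - 40 / t ^ 2 - r)))) (n + 1) 0, ?_, fun D hD hφ => ?_⟩
    · refine le_trans ?_ (query_count_le hX hL2 hL5 hY hR3
        (Nat.cast_nonneg t) ht2)
      exact_mod_cast queries_levelLoop_le ht _ _ R _ (n + 1) 0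
    · have hmean : mean D f = √B * mean D g := by
        simp only [mean, hg, Finset.mul_sum]
        exact Finset.sum_congr rfl fun x _ => by field_simp
      have h2 : secondMoment D g ≤ 1 := by
        have : secondMoment D g = secondMoment D f / B := by
          simp only [secondMoment, hg, div_pow, Real.sq_sqrt hB0.le, Finset.sum_div, mul_div_assoc]
        rw [this, div_le_one hB0]
        exact hφ
      -- Accuracy and restoration are proved as one joint event; both claims follow by monotonicity.
      set P : ℝ → EuclideanSpace ℂ (Ω × Bool × Fin t × Bool) → Prop := fun r v =>
        |mean D f - r| ≤ ε ∧ ∃ χ, v = tensorState (coherentEncoding D) χ with hPdef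
      have hP : ∀ r v (k : ℂ), k ≠ 0 → (P r (k • v) ↔ P r v) := by
        intro r v k hk
        have hts : ∀ (k : ℂ) (χ : EuclideanSpace ℂ (Bool × Fin t × Bool)),
            tensorState (coherentEncoding D) (k • χ) =
              k • tensorState (coherentEncoding D) χ := fun k χ => by
          ext p
          simp only [tensorState, PiLp.smul_apply, smul_eq_mul]
          ring
        refine and_congr_right fun _ => ⟨?_, ?_⟩
        · rintro ⟨χ, h⟩
          exact ⟨k⁻¹ • χ, by rw [hts, ← h, inv_smul_smul₀ hk]⟩
        · rintro ⟨χ, rfl⟩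
          exact ⟨k • χ, (hts k χ).symm⟩
      have hδ : (n + 1 : ℝ) * (2 * (1 / 2) ^ R) ≤ η := by linarith
      have hp0 : (0 : ℝ) < (1 / 2) ^ R := by positivity
      have hδ1 : 2 * (1 / 2 : ℝ) ^ R ≤ 1 := by nlinarith
      have main := le_prob_levelLoop ht hD
        (fun l => levelCosine_sq_le_one hg0 ht9 l)
        (fun l => mean_levelCosine_sq_lt_one hD hg0 ht9 l)
        (fun l => two_pi_le_mul_sqrt hD hg0 ht9 l) hP R hδ1
        (u := fun l r => √B * (2 ^ l * (2 * (1 - 40 / t ^ 2 - r))))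
        (T := fun l => √B * (2 ^ l * mean D (dyadicPart g l)))
        (e := fun l => √B * (2 ^ l * (644 / t ^ 2 + 36 / t * √(mean D (dyadicPart g l)))))
        (fun l r hr => by
          rw [← mul_sub, ← mul_sub, abs_mul, abs_mul, abs_of_pos hsB,
            abs_of_pos (by positivity : (0 : ℝ) < 2 ^ l)]
          have := abs_dyadic_estimate_le hD hg0 ht9 l hr
          gcongr) (n + 1) 0 (fun z' hz' => by
          refine ⟨?_, _, rfl⟩
          rw [add_zero, ← Finset.mul_sum, ← Finset.mul_sum] at hz'
          have h3 := abs_mean_sub_sum_dyadicPart_le hD hg0 h2 n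
          have h4 := sum_two_pow_mul_sqrt_mean_dyadicPart_le hD hg0 h2 n
          have h5 := level_error_le hX hL2 hn1 hn2 ht1
          have h6 : ∑ l ∈ Finset.range (n + 1),
              2 ^ l * (644 / (t : ℝ) ^ 2 + 36 / t * √(mean D (dyadicPart g l))) ≤
              644 * (2 * 2 ^ n) / (t : ℝ) ^ 2 + 36 / t * √(3 * (n + 1)) := by
            have e1 : ∀ l : ℕ, 2 ^ l * (644 / (t : ℝ) ^ 2 + 36 / t * √(mean D (dyadicPart g l))) =
                2 ^ l * (644 / (t : ℝ) ^ 2) +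
                  36 / t * (2 ^ l * √(mean D (dyadicPart g l))) := fun l => by ring
            simp only [e1, Finset.sum_add_distrib, ← Finset.mul_sum, ← Finset.sum_mul]
            have e2 : ∑ l ∈ Finset.range (n + 1), (2 : ℝ) ^ l ≤ 2 * 2 ^ n := by
              rw [geom_sum_eq (by norm_num), pow_succ]
              norm_num
              linarith
            have e3 : 644 * (2 * 2 ^ n) / (t : ℝ) ^ 2 = 2 * 2 ^ n * (644 / (t : ℝ) ^ 2) := by ring
            rw [e3]
            gcongr
          -- Truncation error plus accumulated estimation error.
          have h7 : mean D f - z' = √B * (mean D g -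
              ∑ l ∈ Finset.range (n + 1), 2 ^ l * mean D (dyadicPart g l)) +
              (√B * ∑ l ∈ Finset.range (n + 1), 2 ^ l * mean D (dyadicPart g l) - z') := by
            rw [hmean]; ring
          rw [h7]
          refine (abs_add_le _ _).trans ?_
          rw [abs_mul, abs_of_pos hsB]
          calc _ ≤ √B * (1 / 2 ^ n) + √B * (644 * (2 * 2 ^ n) / (t : ℝ) ^ 2 +
                36 / t * √(3 * (n + 1))) :=
                add_le_add (by gcongr) (hz'.trans (by gcongr))
            _ ≤ √B * (1 / (√B / ε)) := by rw [← mul_add]; gcongr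
            _ = ε := by field_simp)
      -- Bernoulli's inequality in the role of a union bound over the n + 1 levels.
      have hbern := one_add_mul_le_pow (by linarith : (-2 : ℝ) ≤ -(2 * (1 / 2) ^ R)) (n + 1)
      have hlow : 1 - η ≤ (1 - 2 * (1 / 2 : ℝ) ^ R) ^ (n + 1) := by
        push_cast at hbern
        rw [← sub_eq_add_neg] at hbern
        linarith
      exact ⟨(hlow.trans main).trans (QueryAlg.prob_mono _ (fun r v h => h.1) _ _),
        (hlow.trans main).trans (QueryAlg.prob_mono _ (fun r v h => h.2) _ _)⟩
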